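/- Consider, for real coefficients $a_{11},a_{12},a_{21},a_{22}$ and a delay $\tau\ge 0$, the system $$\dot r(t)=a_{11}r(t-\tau)+a_{12}j(t),\qquad \dot j(t)=a_{21}r(t)+a_{22}j(t).$$ It is called stable (for the delay $\tau$) if every solution tends to $(0,0)$ as $t\to+\infty$, and unstable if some solution is unbounded on $[0,\infty)$; a stability switch is a delay $\tau_*>0$ such that the system is stable for all $\tau<\tau_*$ close to $\tau_*$ and unstable for all $\tau>\tau_*$ close to $\tau_*$, or vice versa. (1) For every $n\in\mathbb N=\{0,1,2,\dots\}$ there are non-empty open intervals $I_{kl}$, $k,l\in\{1,2\}$, such that for all $a_{kl}\in I_{kl}$ one has $|a_{12}a_{21}|>|a_{11}a_{22}|$ and the system has exactly $n$ stability switches. (2) Assume $|a_{12}a_{21}|>|a_{11}a_{22}|$, $$\Delta:=(a_{11}^2+a_{22}^2)^2+4a_{12}a_{21}(a_{22}^2-a_{11}^2)>0,\qquad a_{11}^2-a_{22}^2-2a_{12}a_{21}>0 .$$ Then put $y_0=\tfrac12(a_{11}^2-a_{22}^2-2a_{12}a_{21}-\sqrt\Delta)$, $y_1=\tfrac12(a_{11}^2-a_{22}^2-2a_{12}a_{21}+\sqrt\Delta)$,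 and, for $i\in\{0,1\}$, $\omega_i=\sqrt{y_i}$, $$a_i=\frac{a_{12}a_{21}a_{22}}{a_{11}(\omega_i^2+a_{22}^2)},\qquad s_i=-\frac{\omega_i(\omega_i^2+a_{22}^2+a_{12}a_{21})}{a_{11}(\omega_i^2+a_{22}^2)},$$ let $\theta_i=\arccos a_i$ if $s_i\ge 0$ and $\theta_i=2\pi-\arccos a_i$ if $s_i<0$, and let $\tau_{i,k}=\frac{\theta_i}{\omega_i}+\frac{2k\pi}{\omega_i}$ for $k=0,1,2,\dots$. (2a) Suppose that the system is stable for $\tau=0$, and let $m\ge 0$. If $\tau_{1,k}<\tau_{0,k}<\tau_{1,k+1}$ for all $0\le k<m$, then there are at least $2m+1$ stability switches; if moreover $\tau_{1,m+1}\le\tau_{0,m}$, then there are exactly $2m+1$. (2b) Suppose that the system is unstable for $\tau=0$, and let $m\ge 0$. If $\tau_{0,k}<\tau_{1,k}$ for all $0\le k<m$ and $\tau_{1,k}<\tau_{0,k+1}$ for all $k \ge 0$ with $k+1<m$, then there are at least $2m$ stability switches; if moreover $\tau_{1,m}\le\tau_{0,m}$, then there are exactly $2m$. -/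

import Mathlib

open Set Filter Topology

/-- The four real reaction coefficients of the two-partner system. -/
structure Coeffs where
  a11 : ℝ
  a12 : ℝ
  a21 : ℝ
  a22 : ℝ

noncomputable section

namespace Coeffs

/-- `(r, j)` solves `r'(t) = a11 r(t-τ) + a12 j(t)`, `j'(t) = a21 r(t) + a22 j(t)` for `t ≥ 0`
(the derivative at `t = 0` being the right one), with a continuous history on `[-τ, 0]`. -/
structure IsSolution (a : Coeffs) (τ : ℝ) (r j : ℝ → ℝ) : Prop where
  continuousOn_r : ContinuousOn r (Ici (-τ))
  continuousOn_j : ContinuousOn j (Ici (-τ))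
  deriv_r : ∀ t : ℝ, 0 ≤ t →
    HasDerivWithinAt r (a.a11 * r (t - τ) + a.a12 * j t) (Ici 0) t
  deriv_j : ∀ t : ℝ, 0 ≤ t →
    HasDerivWithinAt j (a.a21 * r t + a.a22 * j t) (Ici 0) t

/-- The system with delay `τ` is stable: every solution tends to the equilibrium `(0, 0)`. -/
def IsStable (a : Coeffs) (τ : ℝ) : Prop :=
  ∀ r j : ℝ → ℝ, a.IsSolution τ r j → Tendsto r atTop (𝓝 0) ∧ Tendsto j atTop (𝓝 0)

/-- The system with delay `τ` is unstable: some solution is unbounded in forward time. -/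
def IsUnstable (a : Coeffs) (τ : ℝ) : Prop :=
  ∃ r j : ℝ → ℝ, a.IsSolution τ r j ∧ ∀ M : ℝ, ∃ t : ℝ, 0 ≤ t ∧ M < |r t| + |j t|

/-- A stability switch at the delay `τ₀ > 0`: as the delay increases through `τ₀`, the system
changes from stable to unstable or from unstable to stable. -/
def IsSwitch (a : Coeffs) (τ₀ : ℝ) : Prop :=
  0 < τ₀ ∧
    (((∀ᶠ τ in 𝓝[<] τ₀, a.IsStable τ) ∧ (∀ᶠ τ in 𝓝[>] τ₀, a.IsUnstable τ)) ∨
     ((∀ᶠ τ in 𝓝[<] τ₀, a.IsUnstable τ) ∧ (∀ᶠ τ in 𝓝[>] τ₀, a.IsStable τ)))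

/-- The number of stability switches over all delays. -/
def numSwitches (a : Coeffs) : ℕ∞ := {τ₀ : ℝ | a.IsSwitch τ₀}.encard

/-- The quantity `Δ`. -/
def Delta (a : Coeffs) : ℝ :=
  (a.a11 ^ 2 + a.a22 ^ 2) ^ 2 + 4 * (a.a12 * a.a21) * (a.a22 ^ 2 - a.a11 ^ 2)

/-- `y 0` is the smaller root (sign `-`) and `y 1` the larger one (sign `+`). -/
def y (a : Coeffs) (i : Fin 2) : ℝ :=
  (a.a11 ^ 2 - a.a22 ^ 2 - 2 * (a.a12 * a.a21)
    + (if i = 0 then -1 else 1) * Real.sqrt a.Delta) / 2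

/-- `ω_i = √(y_i)`. -/
def omega (a : Coeffs) (i : Fin 2) : ℝ := Real.sqrt (a.y i)

/-- `a_i`, the value of `cos (ω_i τ)` at a critical delay `τ`. -/
def cosVal (a : Coeffs) (i : Fin 2) : ℝ :=
  a.a12 * a.a21 * a.a22 / (a.a11 * (a.omega i ^ 2 + a.a22 ^ 2))

/-- The value of `sin (ω_i τ)` at a critical delay `τ`. -/
def sinVal (a : Coeffs) (i : Fin 2) : ℝ :=
  -(a.omega i * (a.omega i ^ 2 + a.a22 ^ 2 + a.a12 * a.a21)) /
    (a.a11 * (a.omega i ^ 2 + a.a22 ^ 2))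

/-- The angle in `[0, 2π)` with cosine `cosVal` and sine `sinVal`. -/
def phase (a : Coeffs) (i : Fin 2) : ℝ :=
  if 0 ≤ a.sinVal i then Real.arccos (a.cosVal i)
  else 2 * Real.pi - Real.arccos (a.cosVal i)

/-- The `k`-th critical delay of the sequence with index `i`: the delays at which `±i ω_i` are
characteristic values. -/
def critDelay (a : Coeffs) (i : Fin 2) (k : ℕ) : ℝ :=
  a.phase i / a.omega i + 2 * k * Real.pi / a.omega i

end Coeffs

end

/-!
The stability of the system is governed by the zeros of its characteristic function
`(z - a11 e^{-z τ}) (z - a22) - a12 a21`.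

A zero with positive real part gives an unbounded solution `re (e^{z t} v)`. If there is no zero in
the closed right half plane, all solutions tend to zero (`NoUnstableMode.tendsto_zero`): the
operator that maps the restriction of a solution to a period `[0, τ]` to its restriction to the
next period has no spectrum outside the open unit disc, because its resolvent equation is a
boundary value problem for an ordinary differential equation, with eigenvalues `e^{z τ}` for the
zeros `z`. By Gelfand's formula the powers of this operator tend to zero.

It remains to count the zeros in the open right half plane, with multiplicity, as a function of the
delay (`Coeffs.unstableCount`). They stay in a bounded set, so that by Hurwitz' theorem
(`eventually_zeroCount_ball_eq`, from Rouché's theorem and the argument principle) the count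
changes only when zeros cross the imaginary axis. Taking absolute values in the characteristic
equation at `i ω` gives a quadratic equation for `ω ^ 2` with the two positive roots `y 0 < y 1`, so
that crossings happen exactly at the critical delays. The crossing zeros are simple, and implicit
differentiation shows that their real velocity has the sign of the derivative of the quadratic
polynomial at `ω ^ 2` (`Coeffs.re_charFunDelayDeriv_mul_conj`). Hence a conjugate pair enters the
right half plane at each critical delay of index `1` and leaves it at each one of index `0`
(`Coeffs.HasTwoFrequencies.unstableCount_eq`).

A switch is thus a change between zero and nonzero of
`N + 2 #{k | critDelay 1 k < τ} - 2 #{k | critDelay 0 k < τ}`, where `N` is the count without delay,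
and the sufficient conditions become a statement on two interlacing sequences
(`encard_countSwitches`). Since the count is never negative, the order of the first critical delays
need not be assumed; and since the critical delays of index `1` are more closely spaced, two
coinciding ones are followed by a switch.

For the first claim, at `a22 = 0` the critical delays are explicit and their order depends on the
ratio of the two frequencies, which is arbitrary. Strict inequalities between finitely many
critical delays persist near such a system.
-/

/-! ### Zeros of entire functions in a disc -/

/-- The number of zeros of `f` in `U`, counted with multiplicity. The value is meaningful for an
analytic `f` that has only finitely many zeros in `U`. -/
noncomputable def zeroCount (f : ℂ → ℂ) (U : Set ℂ) : ℕ :=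
  ∑ᶠ z ∈ U, analyticOrderNatAt f z

section zeroCount

variable {f g : ℂ → ℂ} {U V : Set ℂ}

lemma support_analyticOrderNatAt_subset (f : ℂ → ℂ) :
    Function.support (analyticOrderNatAt f) ⊆ {z | f z = 0} := fun _ hz =>
  apply_eq_zero_of_analyticOrderNatAt_ne_zero hz

lemma zeroCount_congr_set (h : ∀ z, f z = 0 → (z ∈ U ↔ z ∈ V)) :
    zeroCount f U = zeroCount f V :=
  finsum_mem_inter_support_eq' _ _ _ fun z hz => h z (support_analyticOrderNatAt_subset f hz)

lemma zeroCount_eq_zero (h : ∀ z ∈ U, f z ≠ 0) : zeroCount f U = 0 := by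
  rw [zeroCount_congr_set (V := ∅) fun z hz => by simpa using fun hU => h z hU hz]
  simp [zeroCount]

lemma analyticOrderAt_ne_top_of_ne_zero (hf : Differentiable ℂ f) {w : ℂ} (hw : f w ≠ 0) (z : ℂ) :
    analyticOrderAt f z ≠ ⊤ := by
  have hA : AnalyticOnNhd ℂ f univ := fun z _ => hf.analyticAt z
  refine AnalyticOnNhd.analyticOrderAt_ne_top_of_isPreconnected hA isPreconnected_univ
    (mem_univ w) (mem_univ z) ?_
  rw [(hf.analyticAt w).analyticOrderAt_eq_zero.2 hw]
  simp

lemma analyticOrderNatAt_pos (hf : Differentiable ℂ f) {w : ℂ} (hw : f w ≠ 0) {z : ℂ}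
    (hz : f z = 0) : 0 < analyticOrderNatAt f z := by
  rw [Nat.pos_iff_ne_zero]
  intro h
  have h1 := Nat.cast_analyticOrderNatAt (analyticOrderAt_ne_top_of_ne_zero hf hw z)
  rw [h, eq_comm] at h1
  exact (hf.analyticAt z).analyticOrderAt_eq_zero.1 (by simpa using h1) hz

lemma finite_zeros_of_isBounded (hf : Differentiable ℂ f) {w : ℂ} (hw : f w ≠ 0)
    (hU : Bornology.IsBounded U) : (U ∩ {z | f z = 0}).Finite := by
  have hA : AnalyticOnNhd ℂ f univ := fun z _ => hf.analyticAt z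
  have h1 := (mem_codiscrete'.1 (hA.preimage_zero_mem_codiscrete hw)).2
  have h2 : (f ⁻¹' {0}ᶜ)ᶜ = {z | f z = 0} := by ext; simp
  rw [h2] at h1
  have hK : IsCompact (closure U ∩ {z | f z = 0}) :=
    hU.isCompact_closure.inter_right (isClosed_eq hf.continuous continuous_const)
  exact (hK.finite (h1.mono inter_subset_right)).subset
    (inter_subset_inter_left _ subset_closure)

lemma zeroCount_pos_iff (hf : Differentiable ℂ f) {w : ℂ} (hw : f w ≠ 0)
    (hfin : (U ∩ {z | f z = 0}).Finite) : 0 < zeroCount f U ↔ ∃ z ∈ U, f z = 0 := by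
  constructor
  · intro h
    by_contra! hne
    exact h.ne' (zeroCount_eq_zero hne)
  · rintro ⟨z, hzU, hz⟩
    rw [zeroCount_congr_set (V := U ∩ {z | f z = 0}) fun z hz => by simp [hz]]
    rw [zeroCount, finsum_mem_eq_finite_toFinset_sum _ hfin]
    exact lt_of_lt_of_le (analyticOrderNatAt_pos hf hw hz)
      (Finset.single_le_sum (f := analyticOrderNatAt f) (fun _ _ => Nat.zero_le _) (by simp [hzU, hz]))

lemma zeroCount_mul (hf : Differentiable ℂ f) (hg : Differentiable ℂ g)
    {w : ℂ} (hfw : f w ≠ 0) (hgw : g w ≠ 0) (hU : Bornology.IsBounded U) :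
    zeroCount (f * g) U = zeroCount f U + zeroCount g U := by
  unfold zeroCount
  rw [← finsum_mem_add_distrib'
    ((finite_zeros_of_isBounded hf hfw hU).subset
      (inter_subset_inter_right _ (support_analyticOrderNatAt_subset f)))
    ((finite_zeros_of_isBounded hg hgw hU).subset
      (inter_subset_inter_right _ (support_analyticOrderNatAt_subset g)))]
  refine finsum_mem_congr rfl fun z _ => ?_
  exact analyticOrderNatAt_mul (hf.analyticAt z) (hg.analyticAt z)
    (analyticOrderAt_ne_top_of_ne_zero hf hfw z) (analyticOrderAt_ne_top_of_ne_zero hg hgw z)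

lemma zeroCount_id_sub_const {w : ℂ} (hw : w ∈ U) : zeroCount (fun z => z - w) U = 1 := by
  rw [zeroCount_congr_set (V := {w}) fun z hz => by simp [sub_eq_zero.1 hz, hw]]
  simp [zeroCount, analyticOrderNatAt, analyticOrderAt_id_sub_const_self]

end zeroCount

section argumentPrinciple

open Metric

variable {f g : ℂ → ℂ} {c : ℂ} {R : ℝ}

/-- The argument principle on a disc, for an entire function without zeros on the boundary circle.
Zeros are divided out one at a time. -/
theorem circleIntegral_logDeriv_eq (hR : 0 < R) (hf : Differentiable ℂ f)
    (h0 : ∀ z ∈ sphere c R, f z ≠ 0) :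
    (∮ z in C(c, R), logDeriv f z) = 2 * Real.pi * Complex.I * zeroCount f (ball c R) := by
  induction hn : zeroCount f (ball c R) generalizing f with
  | zero =>
    have hne : ∀ z ∈ closedBall c R, f z ≠ 0 := by
      intro z hz hz0
      rcases (mem_closedBall.1 hz).lt_or_eq with h | h
      · have hw := h0 (c + R) (by simp [hR.le])
        have := (zeroCount_pos_iff hf hw (finite_zeros_of_isBounded hf hw isBounded_ball)).2
          ⟨z, mem_ball.2 h, hz0⟩
        omega
      · exact h0 z (mem_sphere.2 h) hz0
    rw [Complex.circleIntegral_eq_zero_of_differentiable_on_off_countable hR.le countable_empty]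
    · simp
    · exact hf.deriv.continuous.continuousOn.div hf.continuous.continuousOn hne
    · intro z hz
      exact (hf.deriv z).div (hf z) (hne z (ball_subset_closedBall hz.1))
  | succ n ih =>
    have hw := h0 (c + R) (by simp [hR.le])
    obtain ⟨w, hwb, hw0⟩ := (zeroCount_pos_iff hf hw
      (finite_zeros_of_isBounded hf hw isBounded_ball)).1 (by rw [hn]; omega)
    have hd : Differentiable ℂ (dslope f w) := by
      rw [← differentiableOn_univ]
      exact (Complex.differentiableOn_dslope univ_mem).2 hf.differentiableOn
    have hfac : f = (fun z => z - w) * dslope f w := by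
      funext z
      have := sub_smul_dslope f w z
      simp only [smul_eq_mul, hw0, sub_zero] at this
      simpa using this.symm
    have hg0 : ∀ z ∈ sphere c R, dslope f w z ≠ 0 := by
      intro z hz h
      exact h0 z hz (by rw [hfac]; simp [h])
    have hs0 : ∀ z ∈ sphere c R, z - w ≠ 0 := by
      intro z hz h
      rw [sub_eq_zero] at h
      exact h0 z hz (by rw [h, hw0])
    have hcount : zeroCount (dslope f w) (ball c R) = n := by
      have := zeroCount_mul (f := fun z => z - w) (g := dslope f w) (U := ball c R) (w := c + R)
        (by fun_prop) hd (hs0 _ (by simp [hR.le])) (hg0 _ (by simp [hR.le])) isBounded_ball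
      rw [← hfac, zeroCount_id_sub_const hwb] at this
      omega
    have hlog : ∀ z ∈ sphere c R, logDeriv f z = (z - w)⁻¹ + logDeriv (dslope f w) z := by
      intro z hz
      have h1 := logDeriv_mul (f := fun z => z - w) z (hs0 z hz) (hg0 z hz) (by fun_prop) (hd z)
      have h2 : logDeriv (fun z => z - w) z = (z - w)⁻¹ := by
        rw [logDeriv_apply]
        simp
      rw [← h2, ← h1]
      conv_lhs => rw [hfac]
      rfl
    rw [circleIntegral.integral_congr hR.le hlog, circleIntegral.integral_add,
      circleIntegral.integral_sub_inv_of_mem_ball hwb, ih hd hg0 hcount]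
    · push_cast; ring
    · refine ContinuousOn.circleIntegrable hR.le ?_
      exact ContinuousOn.inv₀ (by fun_prop) hs0
    · refine ContinuousOn.circleIntegrable hR.le ?_
      exact hd.deriv.continuous.continuousOn.div hd.continuous.continuousOn hg0

/-- Rouché's theorem on a disc, for entire functions. The quotient `f / g` stays in the disc of
radius `1` about `1`, so that its logarithm is a primitive of the difference of the logarithmic
derivatives. -/
theorem zeroCount_ball_eq_of_norm_sub_lt (hR : 0 < R) (hf : Differentiable ℂ f)
    (hg : Differentiable ℂ g) (h : ∀ z ∈ sphere c R, ‖f z - g z‖ < ‖g z‖) :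
    zeroCount f (ball c R) = zeroCount g (ball c R) := by
  have hg0 : ∀ z ∈ sphere c R, g z ≠ 0 := by
    intro z hz h0
    have := h z hz
    rw [h0, norm_zero] at this
    exact absurd this (not_lt.2 (norm_nonneg _))
  have hf0 : ∀ z ∈ sphere c R, f z ≠ 0 := by
    intro z hz h0
    have := h z hz
    rw [h0, zero_sub, norm_neg] at this
    exact lt_irrefl _ this
  have hslit : ∀ z ∈ sphere c R, f z / g z ∈ Complex.slitPlane := by
    intro z hz
    have h1 : ‖f z / g z - 1‖ < 1 := by
      rw [div_sub_one (hg0 z hz), norm_div, div_lt_one (norm_pos_iff.2 (hg0 z hz))]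
      exact h z hz
    left
    have h2 := (abs_lt.1 ((Complex.abs_re_le_norm _).trans_lt h1)).1
    simp only [Complex.sub_re, Complex.one_re] at h2
    linarith
  have hzero : (∮ z in C(c, R), (logDeriv f z - logDeriv g z)) = 0 := by
    refine circleIntegral.integral_eq_zero_of_hasDerivWithinAt
      (f := fun z => Complex.log (f z / g z)) hR.le fun z hz => ?_
    have hd := (((hf z).hasDerivAt.div (hg z).hasDerivAt (hg0 z hz)).clog (hslit z hz))
    refine HasDerivAt.hasDerivWithinAt ?_
    convert! hd using 1
    have := hf0 z hz
    have := hg0 z hz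
    simp only [logDeriv_apply, Pi.div_apply]
    field_simp
  rw [circleIntegral.integral_sub, circleIntegral_logDeriv_eq hR hf hf0,
    circleIntegral_logDeriv_eq hR hg hg0, ← mul_sub, mul_eq_zero] at hzero
  · rcases hzero with h1 | h1
    · simp [Real.pi_ne_zero] at h1
    · exact_mod_cast sub_eq_zero.1 h1
  · exact ContinuousOn.circleIntegrable hR.le
      (hf.deriv.continuous.continuousOn.div hf.continuous.continuousOn hf0)
  · exact ContinuousOn.circleIntegrable hR.le
      (hg.deriv.continuous.continuousOn.div hg.continuous.continuousOn hg0)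

/-- Hurwitz' theorem: in a jointly continuous family of entire functions, the number of zeros in a
disc is locally constant as long as no zero crosses the boundary circle. -/
theorem eventually_zeroCount_ball_eq {F : ℝ → ℂ → ℂ} (hF : Continuous fun q : ℝ × ℂ => F q.1 q.2)
    (hd : ∀ t, Differentiable ℂ (F t)) {t₀ : ℝ} (hR : 0 < R)
    (h0 : ∀ z ∈ sphere c R, F t₀ z ≠ 0) :
    ∀ᶠ t in 𝓝 t₀, zeroCount (F t) (ball c R) = zeroCount (F t₀) (ball c R) := by
  have h1 : ∀ᶠ t in 𝓝 t₀, ∀ z ∈ sphere c R, ‖F t z - F t₀ z‖ < ‖F t₀ z‖ := by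
    refine (isCompact_sphere c R).eventually_forall_of_forall_eventually fun z hz => ?_
    have hc1 : Continuous fun q : ℝ × ℂ => ‖F q.1 q.2 - F t₀ q.2‖ :=
      (hF.sub (hF.comp (continuous_const.prodMk continuous_snd))).norm
    have hc2 : Continuous fun q : ℝ × ℂ => ‖F t₀ q.2‖ :=
      (hF.comp (continuous_const.prodMk continuous_snd)).norm
    refine hc1.continuousAt.eventually_lt hc2.continuousAt ?_
    simpa using h0 z hz
  filter_upwards [h1] with t ht
  exact zeroCount_ball_eq_of_norm_sub_lt hR (hd t) (hd t₀) ht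

end argumentPrinciple

/-! ### Zeros of families of entire functions in a region -/

section localCount

open Metric

variable {F : ℝ → ℂ → ℂ} {t₀ : ℝ} {l : Filter ℝ} {U K : Set ℂ}

lemma zeroCount_biUnion {f : ℂ → ℂ} (hf : Differentiable ℂ f) {w : ℂ} (hw : f w ≠ 0)
    (Z : Finset ℂ) (B : ℂ → Set ℂ) (hB : ∀ s ∈ Z, Bornology.IsBounded (B s))
    (hdisj : (Z : Set ℂ).PairwiseDisjoint B) :
    zeroCount f (⋃ s ∈ Z, B s) = ∑ s ∈ Z, zeroCount f (B s) := by
  have h1 : zeroCount f (⋃ s ∈ Z, B s) = zeroCount f (⋃ s ∈ (Z : Set ℂ), B s ∩ {z | f z = 0}) := by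
    refine zeroCount_congr_set fun z hz => ?_
    simp [hz]
  rw [h1, zeroCount, finsum_mem_biUnion
    (hdisj.mono fun s => inter_subset_left) Z.finite_toSet
    (fun s hs => finite_zeros_of_isBounded hf hw (hB s hs)), finsum_mem_coe_finset]
  refine Finset.sum_congr rfl fun s _ => ?_
  exact zeroCount_congr_set fun z hz => by simp [hz]

/-- If, in a jointly continuous family of entire functions, all zeros in `U` stay in a compact set,
then the number of zeros in `U` near the parameter `t₀` is the sum of the local numbers of zeros
in `U` near the zeros of the limiting function. -/
theorem eventually_zeroCount_eq_sum (hF : Continuous fun q : ℝ × ℂ => F q.1 q.2)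
    (hd : ∀ t, Differentiable ℂ (F t)) (hl : l ≤ 𝓝 t₀) {w : ℂ} (hw : F t₀ w ≠ 0)
    (hK : IsCompact K) (hUK : ∀ᶠ t in l, ∀ z ∈ U, F t z = 0 → z ∈ K)
    (Z : Finset ℂ) (hZ : ∀ z ∈ K, F t₀ z = 0 → z ∈ Z) (m : ℂ → ℕ)
    (hm : ∀ s ∈ Z, ∀ᶠ ε in 𝓝[>] (0 : ℝ), ∀ᶠ t in l, zeroCount (F t) (ball s ε ∩ U) = m s) :
    ∀ᶠ t in l, zeroCount (F t) U = ∑ s ∈ Z, m s := by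
  have hdisj : ∀ᶠ ε in 𝓝[>] (0 : ℝ), (Z : Set ℂ).PairwiseDisjoint fun s => ball s ε := by
    have h1 : ∀ s ∈ Z, ∀ s' ∈ Z, ∀ᶠ ε in 𝓝[>] (0 : ℝ), s ≠ s' → Disjoint (ball s ε) (ball s' ε) := by
      intro s _ s' _
      by_cases hss : s = s'
      · simp [hss]
      · have hpos : 0 < dist s s' / 2 := half_pos (dist_pos.2 hss)
        filter_upwards [Ioo_mem_nhdsGT hpos] with ε hε _
        exact ball_disjoint_ball (by linarith [hε.2])
    have h2 := (Z.eventually_all).2 fun s hs => (Z.eventually_all).2 fun s' hs' => h1 s hs s' hs'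
    filter_upwards [h2] with ε hε s hs s' hs' hne
    exact hε s hs s' hs' hne
  obtain ⟨ε, hεm, hεd, hε⟩ := (((Z.eventually_all).2 hm).and
    (hdisj.and self_mem_nhdsWithin)).exists
  have hε0 : (0 : ℝ) < ε := hε
  have hoff : ∀ᶠ t in 𝓝 t₀, ∀ z ∈ K \ ⋃ s ∈ Z, ball s ε, F t z ≠ 0 := by
    refine (hK.diff (isOpen_biUnion fun _ _ => isOpen_ball)).eventually_forall_of_forall_eventually
      fun z hz => ?_
    refine hF.continuousAt.eventually_ne fun h0 => hz.2 ?_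
    exact mem_biUnion (hZ z hz.1 h0) (mem_ball_self hε0)
  have hwt : ∀ᶠ t in 𝓝 t₀, F t w ≠ 0 :=
    (hF.comp (continuous_id.prodMk continuous_const)).continuousAt.eventually_ne hw
  filter_upwards [hl hoff, hl hwt, hUK, (Z.eventually_all).2 hεm] with t h1 h2 h3 h4
  rw [← Finset.sum_congr rfl h4, ← zeroCount_biUnion (hd t) h2 Z _
    (fun s _ => isBounded_ball.subset inter_subset_left)
    (hεd.mono fun s => inter_subset_left)]
  refine zeroCount_congr_set fun z hz => ⟨fun hzU => ?_, fun hzB => ?_⟩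
  · have : z ∈ ⋃ s ∈ Z, ball s ε := by
      by_contra hcon
      exact h1 z ⟨h3 z hzU hz, hcon⟩ hz
    simp only [mem_iUnion, exists_prop] at this ⊢
    obtain ⟨s, hs, hzs⟩ := this
    exact ⟨s, hs, hzs, hzU⟩
  · simp only [mem_iUnion, exists_prop] at hzB
    obtain ⟨s, _, hzs⟩ := hzB
    exact hzs.2

lemma eventually_isolated_zero {f : ℂ → ℂ} (hf : Differentiable ℂ f) {w : ℂ} (hw : f w ≠ 0)
    (s : ℂ) : ∀ᶠ ε in 𝓝[>] (0 : ℝ), ∀ z ∈ closedBall s ε, z ≠ s → f z ≠ 0 := by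
  have h1 : ∀ᶠ z in 𝓝[≠] s, f z ≠ 0 := by
    rcases (hf.analyticAt s).eventually_eq_zero_or_eventually_ne_zero with h | h
    · exact absurd (analyticOrderAt_eq_top.2 h) (analyticOrderAt_ne_top_of_ne_zero hf hw s)
    · exact h
  rw [eventually_nhdsWithin_iff, Metric.eventually_nhds_iff_ball] at h1
  obtain ⟨δ, hδ, h⟩ := h1
  filter_upwards [Ioo_mem_nhdsGT hδ] with ε hε z hz hne
  exact h z (closedBall_subset_ball hε.2 hz) hne

lemma eventually_zeroCount_small_ball (hF : Continuous fun q : ℝ × ℂ => F q.1 q.2)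
    (hd : ∀ t, Differentiable ℂ (F t)) {w : ℂ} (hw : F t₀ w ≠ 0) (s : ℂ) :
    ∀ᶠ ε in 𝓝[>] (0 : ℝ), ∀ᶠ t in 𝓝 t₀,
      zeroCount (F t) (ball s ε) = analyticOrderNatAt (F t₀) s := by
  filter_upwards [eventually_isolated_zero (hd t₀) hw s, self_mem_nhdsWithin] with ε hε hε0
  have hε0 : (0 : ℝ) < ε := hε0
  have h1 : zeroCount (F t₀) (ball s ε) = analyticOrderNatAt (F t₀) s := by
    rw [zeroCount_congr_set (V := {s}) fun z hz => ⟨fun hzb => ?_, fun hzs => ?_⟩]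
    · simp [zeroCount]
    · by_contra hne
      exact hε z (ball_subset_closedBall hzb) hne hz
    · rw [mem_singleton_iff.1 hzs]
      exact mem_ball_self hε0
  filter_upwards [eventually_zeroCount_ball_eq hF hd hε0 (c := s) (t₀ := t₀) fun z hz =>
    hε z (sphere_subset_closedBall hz) (by
      rintro rfl
      simp [hε0.ne] at hz)] with t ht
  rw [ht, h1]

/-- The direction in which a simple zero on the imaginary axis moves with the parameter: by
implicit differentiation its velocity is `-B / A`, where `A` and `B` are the partial derivatives in
the space variable and in the parameter. -/
theorem eventually_re_sign_of_zero {s A B : ℂ} (hs : s.re = 0) (h0 : F t₀ s = 0)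
    (hder : HasFDerivAt (𝕜 := ℝ) (fun q : ℝ × ℂ => F q.1 q.2)
      ((ContinuousLinearMap.fst ℝ ℝ ℂ).smulRight B +
        (ContinuousLinearMap.mul ℝ ℂ A).comp (ContinuousLinearMap.snd ℝ ℝ ℂ)) (t₀, s))
    (hD : (-(B * (starRingEnd ℂ) A)).re ≠ 0) :
    ∀ᶠ q : ℝ × ℂ in 𝓝 (t₀, s), F q.1 q.2 = 0 → q.1 ≠ t₀ →
      0 < (-(B * (starRingEnd ℂ) A)).re * (q.1 - t₀) * q.2.re := by
  set D := (-(B * (starRingEnd ℂ) A)).re with hDdef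
  have hA : A ≠ 0 := by
    rintro rfl
    simp [hDdef] at hD
  have hA' : 0 < ‖A‖ := norm_pos_iff.2 hA
  set C : ℝ := 2 * (‖B‖ + ‖A‖) / ‖A‖ with hC
  have hC0 : 0 ≤ C := by positivity
  set κ : ℝ := min (‖A‖ / 2) (|D| / (2 * ‖A‖ * (1 + C))) with hκ
  have hκ0 : 0 < κ := lt_min (by positivity) (by have := abs_pos.2 hD; positivity)
  have hlit := hder.isLittleO.def hκ0
  filter_upwards [hlit] with q hq hz hne
  obtain ⟨t, z⟩ := q
  simp only [h0, add_apply, ContinuousLinearMap.smulRight_apply,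
    ContinuousLinearMap.coe_fst', ContinuousLinearMap.comp_apply, ContinuousLinearMap.coe_snd',
    ContinuousLinearMap.mul_apply', Prod.fst_sub, Prod.snd_sub, sub_zero] at hq hz hne ⊢
  rw [hz, zero_sub, norm_neg] at hq
  set x := t - t₀ with hx
  have hx0 : x ≠ 0 := sub_ne_zero.2 hne
  set e := x • B + A * (z - s) with he
  have hprod : ‖((t, z) : ℝ × ℂ) - (t₀, s)‖ ≤ |x| + ‖z - s‖ := by
    rw [Prod.mk_sub_mk, Prod.norm_mk, Real.norm_eq_abs]
    exact max_le (by simp [hx]) (by simp)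
  have he1 : ‖e‖ ≤ κ * (|x| + ‖z - s‖) := hq.trans (by gcongr)
  have hzs : ‖z - s‖ ≤ C * |x| := by
    have h1 : A * (z - s) = e - x • B := by rw [he]; ring
    have h2 : ‖A‖ * ‖z - s‖ ≤ ‖e‖ + |x| * ‖B‖ := by
      rw [← norm_mul, h1]
      refine (norm_sub_le _ _).trans ?_
      rw [norm_smul, Real.norm_eq_abs]
    have h3 : κ * (|x| + ‖z - s‖) ≤ ‖A‖ / 2 * (|x| + ‖z - s‖) := by
      gcongr
      exact min_le_left _ _
    have h4 : ‖A‖ / 2 * ‖z - s‖ ≤ (‖B‖ + ‖A‖) * |x| := by nlinarith [abs_nonneg x]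
    rw [hC, div_mul_eq_mul_div, le_div_iff₀ hA']
    nlinarith
  have he2 : ‖e‖ * ‖A‖ ≤ |D| / 2 * |x| := by
    have h1 : κ * (2 * ‖A‖ * (1 + C)) ≤ |D| := by
      rw [← le_div_iff₀ (by positivity)]
      exact min_le_right _ _
    have h2 : ‖e‖ ≤ κ * ((1 + C) * |x|) := he1.trans (by gcongr; linarith)
    nlinarith [abs_nonneg x, mul_le_mul_of_nonneg_right h2 hA'.le,
      mul_le_mul_of_nonneg_right h1 (abs_nonneg x)]
  have hre : ‖A‖ ^ 2 * z.re = x * D + (e * (starRingEnd ℂ) A).re := by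
    have h1 : (starRingEnd ℂ) A * A = ((‖A‖ ^ 2 : ℝ) : ℂ) := by
      rw [mul_comm, Complex.mul_conj, Complex.normSq_eq_norm_sq]
    have h2 : e * (starRingEnd ℂ) A
        = (x : ℂ) * (B * (starRingEnd ℂ) A) + ((‖A‖ ^ 2 : ℝ) : ℂ) * (z - s) := by
      rw [he, ← h1, Complex.real_smul]; ring
    rw [h2, Complex.add_re, Complex.re_ofReal_mul, Complex.re_ofReal_mul, hDdef, Complex.neg_re,
      Complex.sub_re, hs]
    ring
  have herr : |(e * (starRingEnd ℂ) A).re| ≤ |D| / 2 * |x| := by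
    refine (Complex.abs_re_le_norm _).trans ?_
    rw [norm_mul, RCLike.norm_conj]
    exact he2
  have hDx : 0 < |D| * |x| := mul_pos (abs_pos.2 hD) (abs_pos.2 hx0)
  have h3 : |D * x * (e * (starRingEnd ℂ) A).re| ≤ (|D| * |x|) * (|D| * |x|) / 2 := by
    rw [abs_mul, abs_mul]
    nlinarith
  have h4 : (D * x) * (D * x) = (|D| * |x|) * (|D| * |x|) := by
    rw [← abs_mul, abs_mul_abs_self]
  have h5 : 0 < ‖A‖ ^ 2 * (D * x * z.re) := by
    have : ‖A‖ ^ 2 * (D * x * z.re) = (D * x) * (D * x) + D * x * (e * (starRingEnd ℂ) A).re := by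
      calc _ = D * x * (‖A‖ ^ 2 * z.re) := by ring
        _ = _ := by rw [hre]; ring
    rw [this, h4]
    nlinarith [(abs_le.1 h3).1, mul_pos hDx hDx]
  exact pos_of_mul_pos_right h5 (by positivity)

/-- A simple zero on the imaginary axis enters the open right half plane as the parameter moves
from `t₀` along `l` if the sign of `D`, that of its real velocity, agrees with the direction of `l`,
and otherwise stays out of it. -/
theorem eventually_zeroCount_crossing (hF : Continuous fun q : ℝ × ℂ => F q.1 q.2)
    (hd : ∀ t, Differentiable ℂ (F t)) (hl : l ≤ 𝓝[≠] t₀) {w : ℂ} (hw : F t₀ w ≠ 0)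
    {s : ℂ} (hord : analyticOrderNatAt (F t₀) s = 1) {D : ℝ}
    (hsign : ∀ᶠ q : ℝ × ℂ in 𝓝 (t₀, s), F q.1 q.2 = 0 → q.1 ≠ t₀ → 0 < D * (q.1 - t₀) * q.2.re)
    (n : ℕ) (hn : (n = 1 ∧ ∀ᶠ t in l, 0 < D * (t - t₀)) ∨ (n = 0 ∧ ∀ᶠ t in l, D * (t - t₀) < 0)) :
    ∀ᶠ ε in 𝓝[>] (0 : ℝ), ∀ᶠ t in l, zeroCount (F t) (ball s ε ∩ {z | 0 < z.re}) = n := by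
  rw [nhds_prod_eq, eventually_prod_iff] at hsign
  obtain ⟨p, hp, q, hq, hpq⟩ := hsign
  obtain ⟨δ, hδ, hδq⟩ := Metric.eventually_nhds_iff_ball.1 hq
  filter_upwards [eventually_zeroCount_small_ball hF hd hw s, Ioo_mem_nhdsGT hδ] with ε hε hεδ
  have hl' : l ≤ 𝓝 t₀ := hl.trans nhdsWithin_le_nhds
  have hne : ∀ᶠ t in l, t ≠ t₀ := hl self_mem_nhdsWithin
  rcases hn with ⟨rfl, hn⟩ | ⟨rfl, hn⟩
  · filter_upwards [hl' hε, hl' hp, hne, hn] with t h1 h2 h3 h4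
    rw [zeroCount_congr_set (V := ball s ε), h1, hord]
    intro z hz
    refine ⟨fun h => h.1, fun h => ⟨h, ?_⟩⟩
    exact pos_of_mul_pos_right (hpq h2 (hδq z (ball_subset_ball hεδ.2.le h)) hz h3) h4.le
  · filter_upwards [hl' hp, hne, hn] with t h2 h3 h4
    refine zeroCount_eq_zero fun z hz h0 => ?_
    have := hpq h2 (hδq z (ball_subset_ball hεδ.2.le hz.1)) h0 h3
    have hzr : 0 < z.re := hz.2
    nlinarith

end localCount

/-! ### Stability of linear delay equations -/

section linearODE

open NormedSpace

variable {E : Type*} [NormedAddCommGroup E] [NormedSpace ℂ E] [CompleteSpace E]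

lemma hasDerivAt_exp_smul_apply (A : E →L[ℂ] E) {u : ℝ → E} {u' : E} {t : ℝ}
    (hu : HasDerivAt u u' t) :
    HasDerivAt (fun s : ℝ => exp (s • A) (u s)) (A (exp (t • A) (u t)) + exp (t • A) u') t := by
  have h1 := hasDerivAt_exp_smul_const' (𝕂 := ℝ) A t
  have h2 := ((ContinuousLinearMap.restrictScalarsL ℂ E E ℝ ℝ).hasFDerivAt
    (x := exp (t • A))).comp_hasDerivAt t h1
  exact h2.clm_apply hu

lemma continuous_exp_smul (A : E →L[ℂ] E) : Continuous fun s : ℝ => exp (s • A) :=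
  continuous_iff_continuousAt.2 fun t => (hasDerivAt_exp_smul_const (𝕂 := ℝ) A t).continuousAt

lemma continuous_exp_neg_smul_apply (A : E →L[ℂ] E) {g : ℝ → E} (hg : Continuous g) :
    Continuous fun s : ℝ => exp ((-s) • A) (g s) :=
  ((continuous_exp_smul A).comp continuous_neg).clm_apply hg

lemma exp_smul_exp_neg_smul (A : E →L[ℂ] E) (t : ℝ) (x : E) :
    exp (t • A) (exp ((-t) • A) x) = x := by
  have h : exp (t • A) * exp ((-t) • A) = 1 := by
    let : NormedAlgebra ℚ (E →L[ℂ] E) := NormedAlgebra.restrictScalars ℚ ℂ _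
    rw [← exp_add_of_commute, ← add_smul]
    · simp
    · exact ((Commute.refl A).smul_left t).smul_right (-t)
  rw [← mul_apply_eq_comp, h, one_apply_eq_self]

/-- The solution of `u' = A u + g`, `u 0 = c`, by variation of constants. -/
noncomputable def linearFlow (A : E →L[ℂ] E) (g : ℝ → E) (c : E) (t : ℝ) : E :=
  exp (t • A) (c + ∫ s in (0 : ℝ)..t, exp ((-s) • A) (g s))

omit [CompleteSpace E] in
lemma linearFlow_zero (A : E →L[ℂ] E) (g : ℝ → E) (c : E) : linearFlow A g c 0 = c := by
  simp [linearFlow]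

lemma hasDerivAt_linearFlow (A : E →L[ℂ] E) {g : ℝ → E} (hg : Continuous g) (c : E) (t : ℝ) :
    HasDerivAt (linearFlow A g c) (A (linearFlow A g c t) + g t) t := by
  have hc := continuous_exp_neg_smul_apply A hg
  have h1 : HasDerivAt (fun t : ℝ => c + ∫ s in (0 : ℝ)..t, exp ((-s) • A) (g s))
      (exp ((-t) • A) (g t)) t :=
    (hc.integral_hasStrictDerivAt 0 t).hasDerivAt.const_add c
  have h2 := hasDerivAt_exp_smul_apply A h1
  rw [exp_smul_exp_neg_smul] at h2
  exact h2

lemma continuous_linearFlow (A : E →L[ℂ] E) {g : ℝ → E} (hg : Continuous g) (c : E) :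
    Continuous (linearFlow A g c) :=
  continuous_iff_continuousAt.2 fun t => (hasDerivAt_linearFlow A hg c t).continuousAt

lemma eqOn_linearFlow (A : E →L[ℂ] E) {g v : ℝ → E} (hg : Continuous g) {σ : ℝ}
    (hv : ContinuousOn v (Icc 0 σ))
    (hv' : ∀ t ∈ Ico 0 σ, HasDerivWithinAt v (A (v t) + g t) (Ici t) t) :
    EqOn v (linearFlow A g (v 0)) (Icc 0 σ) := by
  refine ODE_solution_unique_of_mem_Icc_right (v := fun t x => A x + g t) (s := fun _ => univ)
    (K := ‖A‖₊) (fun t _ => ?_) hv hv' (fun _ _ => mem_univ _)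
    (continuous_linearFlow A hg _).continuousOn
    (fun t _ => (hasDerivAt_linearFlow A hg _ t).hasDerivWithinAt) (fun _ _ => mem_univ _)
    (linearFlow_zero A g _).symm
  refine LipschitzWith.lipschitzOnWith (LipschitzWith.of_dist_le_mul fun x y => ?_)
  rw [dist_add_right]
  exact A.lipschitz.dist_le_mul x y

/-- An eigenvalue of `exp (σ A)` is the exponential of `σ` times an eigenvalue of `A`: the
eigenspace is invariant under `A`. -/
lemma exists_eigenvalue_of_exp [FiniteDimensional ℂ E] (A : E →L[ℂ] E) (σ : ℝ) {μ : ℂ} {x : E}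
    (hx : x ≠ 0) (h : exp (σ • A) x = μ • x) :
    ∃ (ν : ℂ) (v : E), v ≠ 0 ∧ A v = ν • v ∧ Complex.exp (ν * σ) = μ := by
  have hcomm : ∀ y, exp (σ • A) (A y) = A (exp (σ • A) y) := by
    intro y
    have : Commute (exp (σ • A)) A := ((Commute.refl A).smul_left σ).exp_left
    exact congrArg (fun f : E →L[ℂ] E => f y) this.eq
  let W : Submodule ℂ E :=
    LinearMap.ker ((exp (σ • A) - μ • (1 : E →L[ℂ] E) : E →L[ℂ] E) : E →ₗ[ℂ] E)
  have hW : ∀ y, y ∈ W ↔ exp (σ • A) y = μ • y := by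
    intro y
    simp [W, sub_eq_zero]
  have hinv : ∀ y ∈ W, (A : E →ₗ[ℂ] E) y ∈ W := by
    intro y hy
    rw [hW] at hy ⊢
    simp only [ContinuousLinearMap.coe_coe]
    rw [hcomm, hy, map_smul]
  have : Nontrivial W := ⟨⟨⟨x, (hW x).2 h⟩, 0, fun h0 => hx (congrArg Subtype.val h0)⟩⟩
  obtain ⟨ν, hν⟩ := Module.End.exists_eigenvalue ((A : E →ₗ[ℂ] E).restrict hinv)
  obtain ⟨v, hv⟩ := hν.exists_hasEigenvector
  have hv0 : (v : E) ≠ 0 := fun h0 => hv.2 (Subtype.ext h0)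
  have hAv : A v = ν • (v : E) := congrArg Subtype.val hv.apply_eq_smul
  refine ⟨ν, v, hv0, hAv, ?_⟩
  have hflow : EqOn (fun t : ℝ => Complex.exp (ν * t) • (v : E))
      (linearFlow A (fun _ => 0) (Complex.exp (ν * (0 : ℝ)) • (v : E))) (Icc 0 |σ|) := by
    refine eqOn_linearFlow A continuous_const (by fun_prop) fun t _ => ?_
    have h1 : HasDerivAt (fun t : ℝ => Complex.exp (ν * t)) (Complex.exp (ν * t) * ν) t := by
      have := ((hasDerivAt_id (t : ℂ)).const_mul ν).cexp.comp_ofReal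
      simpa using this
    convert! (h1.smul_const (v : E)).hasDerivWithinAt using 1
    simp [hAv, smul_smul]
  have h2 := hflow (x := |σ|) ⟨abs_nonneg _, le_rfl⟩
  have h3 : exp (|σ| • A) (v : E) = Complex.exp (ν * |σ|) • (v : E) := by
    simpa [linearFlow] using h2.symm
  have h4 : exp (σ • A) (v : E) = Complex.exp (ν * σ) • (v : E) := by
    rcases abs_choice σ with hσ | hσ
    · rwa [hσ] at h3
    · rw [hσ] at h3
      have h5 := exp_smul_exp_neg_smul A σ (v : E)
      rw [h3, map_smul] at h5
      calc exp (σ • A) (v : E)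
          = Complex.exp (ν * σ) • (Complex.exp (ν * (-σ : ℝ)) • exp (σ • A) (v : E)) := by
            rw [smul_smul, ← Complex.exp_add]
            simp
        _ = _ := by rw [h5]
  have h6 := (hW v).1 v.2
  rw [h4] at h6
  exact smul_left_injective ℂ hv0 h6

end linearODE

section delayOperator

open NormedSpace

variable {E : Type*} [NormedAddCommGroup E] [NormedSpace ℂ E] [CompleteSpace E]

variable {σ : ℝ} (hσ : 0 < σ)

/-- The step operator of the delay equation `w'(t) = A w(t) + B w(t - σ)`, on segments of length
`σ`: it maps the restriction of a solution to one period to its restriction to the next. -/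
noncomputable def delayStep (A B : E →L[ℂ] E) : C(Icc 0 σ, E) →L[ℂ] C(Icc 0 σ, E) :=
  LinearMap.mkContinuousOfExistsBound
    { toFun := fun w =>
        ⟨fun t => linearFlow A (fun s => B (IccExtend hσ.le w s)) (w ⟨σ, hσ.le, le_rfl⟩) t,
          (continuous_linearFlow A (B.continuous.comp w.continuous.Icc_extend') _).comp
            continuous_subtype_val⟩
      map_add' := fun w₁ w₂ => by
        ext t
        have h1 := (continuous_exp_neg_smul_apply A (B.continuous.comp
          (w₁.continuous.Icc_extend' (h := hσ.le)))).intervalIntegrable (μ := MeasureTheory.volume) 0 t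
        have h2 := (continuous_exp_neg_smul_apply A (B.continuous.comp
          (w₂.continuous.Icc_extend' (h := hσ.le)))).intervalIntegrable (μ := MeasureTheory.volume) 0 t
        simp only [Function.comp_def] at h1 h2
        simp only [linearFlow, ContinuousMap.coe_mk, ContinuousMap.add_apply, ← map_add]
        congr 1
        rw [add_add_add_comm, ← intervalIntegral.integral_add h1 h2]
        simp [IccExtend]
      map_smul' := fun k w => by
        ext t
        simp [linearFlow, IccExtend, smul_add] }
    (by
      obtain ⟨M, hM⟩ := (isCompact_Icc (a := -σ) (b := σ)).exists_bound_of_continuousOn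
        (continuous_exp_smul A).continuousOn
      have hM0 : 0 ≤ M := (norm_nonneg _).trans (hM 0 ⟨by linarith, hσ.le⟩)
      refine ⟨M * (1 + M * ‖B‖ * σ), fun w => ?_⟩
      refine (ContinuousMap.norm_le _ (by positivity)).2 fun t => ?_
      have hint : ‖∫ s in (0 : ℝ)..t, exp ((-s) • A) (B (IccExtend hσ.le w s))‖
          ≤ (M * (‖B‖ * ‖w‖)) * |(t : ℝ) - 0| := by
        refine intervalIntegral.norm_integral_le_of_norm_le_const fun s hs => ?_
        rw [uIoc_of_le t.2.1] at hs
        refine (ContinuousLinearMap.le_opNorm _ _).trans ?_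
        refine mul_le_mul (hM _ ⟨?_, ?_⟩) ?_ (norm_nonneg _) hM0
        · linarith [hs.2, t.2.2]
        · linarith [hs.1]
        · refine (ContinuousLinearMap.le_opNorm _ _).trans ?_
          gcongr
          exact ContinuousMap.norm_coe_le_norm w _
      have ht : |(t : ℝ) - 0| ≤ σ := by
        rw [sub_zero, abs_of_nonneg t.2.1]
        exact t.2.2
      have h1 : ‖w ⟨σ, hσ.le, le_rfl⟩‖ ≤ ‖w‖ := ContinuousMap.norm_coe_le_norm w _
      calc ‖linearFlow A (fun s => B (IccExtend hσ.le w s)) (w ⟨σ, hσ.le, le_rfl⟩) t‖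
          ≤ M * (‖w‖ + (M * (‖B‖ * ‖w‖)) * σ) := by
            refine (ContinuousLinearMap.le_opNorm _ _).trans ?_
            refine mul_le_mul (hM _ ⟨by linarith [t.2.1], t.2.2⟩) ?_ (norm_nonneg _) hM0
            exact (norm_add_le _ _).trans (add_le_add h1 (hint.trans (by gcongr)))
        _ = M * (1 + M * ‖B‖ * σ) * ‖w‖ := by ring)

lemma delayStep_apply (A B : E →L[ℂ] E) (w : C(Icc 0 σ, E)) (t : Icc 0 σ) :
    delayStep hσ A B w t
      = linearFlow A (fun s => B (IccExtend hσ.le w s)) (w ⟨σ, hσ.le, le_rfl⟩) t := rfl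

/-- A solution of the delay equation on one period, started from the segment `w`, is the image
of `w` under the step operator. -/
lemma delayStep_eq_of_hasDerivWithinAt (A B : E →L[ℂ] E) (w : C(Icc 0 σ, E)) {v : ℝ → E}
    (hv : ContinuousOn v (Icc 0 σ)) (hv0 : v 0 = w ⟨σ, hσ.le, le_rfl⟩)
    (hv' : ∀ t ∈ Ico 0 σ, HasDerivWithinAt v (A (v t) + B (IccExtend hσ.le w t)) (Ici t) t)
    (t : Icc 0 σ) : delayStep hσ A B w t = v t := by
  rw [delayStep_apply, ← hv0]
  exact (eqOn_linearFlow A (B.continuous.comp w.continuous.Icc_extend') hv hv' t.2).symm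

/-- The characteristic equation has no root with nonnegative real part: there is no solution
`exp (ν t) v` of `w'(t) = A w(t) + B w(t - σ)` with `0 ≤ re ν`. -/
def NoUnstableMode (A B : E →L[ℂ] E) (σ : ℝ) : Prop :=
  ∀ (ν : ℂ) (v : E), 0 ≤ ν.re → A v + Complex.exp (-(ν * σ)) • B v = ν • v → v = 0

variable {A B : E →L[ℂ] E}

lemma NoUnstableMode.injective [FiniteDimensional ℂ E] (hσ : 0 < σ) (h : NoUnstableMode A B σ)
    {μ : ℂ} (hμ : 1 ≤ ‖μ‖) {x : E} (hx : exp (σ • (A + μ⁻¹ • B)) x = μ • x) : x = 0 := by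
  by_contra hx0
  obtain ⟨ν, v, hv, hAv, hν⟩ := exists_eigenvalue_of_exp _ σ hx0 hx
  refine hv (h ν v ?_ ?_)
  · rw [← hν, Complex.norm_exp, Real.one_le_exp_iff] at hμ
    simp only [Complex.mul_re, Complex.ofReal_re, Complex.ofReal_im, mul_zero, sub_zero] at hμ
    exact nonneg_of_mul_nonneg_left hμ hσ
  · rw [Complex.exp_neg, hν]
    simpa using hAv

/-- Without unstable modes, the closed exterior of the unit disc lies in the resolvent set of the
step operator: the resolvent equation is a boundary value problem for `u' = (A + μ⁻¹ B) u + f`,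
which is solvable because `μ` is not an eigenvalue of the flow of `A + μ⁻¹ B`. -/
lemma NoUnstableMode.isUnit_sub_delayStep [FiniteDimensional ℂ E] (h : NoUnstableMode A B σ)
    {μ : ℂ} (hμ : 1 ≤ ‖μ‖) :
    IsUnit (μ • (1 : C(Icc 0 σ, E) →L[ℂ] C(Icc 0 σ, E)) - delayStep hσ A B) := by
  have hμ0 : μ ≠ 0 := by
    rintro rfl
    norm_num at hμ
  set L : E →L[ℂ] E := A + μ⁻¹ • B with hL
  rw [ContinuousLinearMap.isUnit_iff_bijective]
  constructor
  · rw [injective_iff_map_eq_zero]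
    intro w hw
    have hTw : delayStep hσ A B w = μ • w := by
      have h1 : μ • w - delayStep hσ A B w = 0 := hw
      exact (sub_eq_zero.1 h1).symm
    set u := linearFlow A (fun s => B (IccExtend hσ.le w s)) (w ⟨σ, hσ.le, le_rfl⟩) with hu
    have hcont : Continuous fun s => B (IccExtend hσ.le w s) :=
      B.continuous.comp w.continuous.Icc_extend'
    have huw : ∀ t : Icc 0 σ, u t = μ • w t := fun t => by
      rw [hu, ← delayStep_apply hσ, hTw]
      rfl
    have hflow : EqOn u (linearFlow L (fun _ => 0) (u 0)) (Icc 0 σ) := by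
      refine eqOn_linearFlow L continuous_const (continuous_linearFlow A hcont _).continuousOn
        fun t ht => ?_
      convert! (hasDerivAt_linearFlow A hcont (w ⟨σ, hσ.le, le_rfl⟩) t).hasDerivWithinAt using 1
      have ht' : t ∈ Icc 0 σ := ⟨ht.1, ht.2.le⟩
      have h1 : IccExtend hσ.le w t = μ⁻¹ • u t := by
        rw [IccExtend_of_mem _ _ ht', huw ⟨t, ht'⟩, smul_smul, inv_mul_cancel₀ hμ0, one_smul]
      rw [h1]
      simp [hL, hu]
    have hu0 : u 0 = w ⟨σ, hσ.le, le_rfl⟩ := linearFlow_zero _ _ _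
    have hzero : u 0 = 0 := by
      refine h.injective hσ hμ ?_
      have h1 := hflow (x := σ) ⟨hσ.le, le_rfl⟩
      rw [huw ⟨σ, hσ.le, le_rfl⟩, ← hu0] at h1
      have h2 : exp (σ • L) (u 0) = μ • u 0 := by simpa [linearFlow] using h1.symm
      exact h2
    ext t
    have h1 := hflow t.2
    rw [huw t, hzero] at h1
    simpa [linearFlow, hμ0] using h1
  · intro g
    set G := IccExtend hσ.le g with hG
    have hGc : Continuous G := g.continuous.Icc_extend'
    have hGc' : Continuous fun s => μ⁻¹ • B (G s) := (B.continuous.comp hGc).const_smul _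
    -- the boundary condition `μ u(0) - u(σ) = g(σ)`
    obtain ⟨c, hc⟩ : ∃ c : E, μ • c - linearFlow L (fun s => μ⁻¹ • B (G s)) c σ = G σ := by
      have hinj : Function.Injective
          ((μ • (1 : E →L[ℂ] E) - exp (σ • L) : E →L[ℂ] E) : E →ₗ[ℂ] E) := by
        rw [injective_iff_map_eq_zero]
        intro x hx
        refine h.injective hσ hμ ?_
        have h1 : μ • x - exp (σ • L) x = 0 := hx
        exact (sub_eq_zero.1 h1).symm
      obtain ⟨c, hc⟩ := LinearMap.surjective_of_injective hinj
        (G σ + exp (σ • L) (∫ s in (0 : ℝ)..σ, exp ((-s) • L) (μ⁻¹ • B (G s))))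
      refine ⟨c, ?_⟩
      simp only [linearFlow, map_add]
      rw [← sub_sub, sub_eq_iff_eq_add, ← hc]
      rfl
    set u := linearFlow L (fun s => μ⁻¹ • B (G s)) c with hu
    have huc : Continuous u := continuous_linearFlow L hGc' c
    set w : C(Icc 0 σ, E) := ⟨fun t => μ⁻¹ • (u t + g t),
      ((huc.comp continuous_subtype_val).add g.continuous).const_smul _⟩ with hw
    have hstep : ∀ t, delayStep hσ A B w t = u t := by
      refine delayStep_eq_of_hasDerivWithinAt hσ A B w huc.continuousOn ?_ fun t ht => ?_
      · have h1 : G σ = g ⟨σ, hσ.le, le_rfl⟩ := IccExtend_of_mem _ _ ⟨hσ.le, le_rfl⟩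
        have h2 : u 0 = c := linearFlow_zero _ _ _
        rw [h2, hw, ContinuousMap.coe_mk, ← h1, ← hc]
        simp [smul_smul, hμ0]
      · have ht' : t ∈ Icc 0 σ := ⟨ht.1, ht.2.le⟩
        convert! (hasDerivAt_linearFlow L hGc' c t).hasDerivWithinAt using 1
        have h1 : G t = g ⟨t, ht'⟩ := IccExtend_of_mem _ _ ht'
        rw [IccExtend_of_mem _ _ ht', h1]
        simp [hw, hL, hu, add_assoc]
    refine ⟨w, ?_⟩
    ext t
    have h1 : (μ • w) t - delayStep hσ A B w t = g t := by
      rw [hstep t]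
      simp [hw, smul_smul, hμ0]
    exact h1

lemma tendsto_norm_pow_of_spectrum_subset_ball {𝔸 : Type*} [NormedRing 𝔸] [NormedAlgebra ℂ 𝔸]
    [CompleteSpace 𝔸] [Nontrivial 𝔸] {T : 𝔸} (hT : ∀ μ ∈ spectrum ℂ T, ‖μ‖ < 1) :
    Tendsto (fun n : ℕ => ‖T ^ n‖) atTop (𝓝 0) := by
  have h1 : spectralRadius ℂ T < (1 : NNReal) :=
    spectrum.spectralRadius_lt_of_forall_lt T fun μ hμ => by exact_mod_cast hT μ hμ
  obtain ⟨r, hr1, hr2⟩ := ENNReal.lt_iff_exists_nnreal_btwn.1 h1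
  have hr : (r : ℝ) < 1 := by exact_mod_cast hr2
  have h2 := (spectrum.pow_nnnorm_pow_one_div_tendsto_nhds_spectralRadius T).eventually_lt_const hr1
  refine squeeze_zero' (Eventually.of_forall fun n => norm_nonneg _) ?_
    (tendsto_pow_atTop_nhds_zero_of_lt_one r.2 hr)
  filter_upwards [h2, eventually_gt_atTop 0] with n hn hn0
  have h3 : (‖T ^ n‖₊ : ENNReal) ≤ (r : ENNReal) ^ n := by
    have h4 := ENNReal.rpow_le_rpow hn.le (Nat.cast_nonneg n : (0 : ℝ) ≤ n)
    rwa [← ENNReal.rpow_mul, one_div, inv_mul_cancel₀ (by positivity), ENNReal.rpow_one,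
      ENNReal.rpow_natCast] at h4
  exact_mod_cast h3

lemma tendsto_norm_pow_apply {X : Type*} [NormedAddCommGroup X] [NormedSpace ℂ X]
    [CompleteSpace X] [Nontrivial X] {T : X →L[ℂ] X}
    (hT : ∀ μ : ℂ, 1 ≤ ‖μ‖ → IsUnit (μ • (1 : X →L[ℂ] X) - T)) (x : X) :
    Tendsto (fun n : ℕ => ‖(T ^ n) x‖) atTop (𝓝 0) := by
  have hpow : Tendsto (fun n : ℕ => ‖T ^ n‖) atTop (𝓝 0) := by
    refine tendsto_norm_pow_of_spectrum_subset_ball fun μ hμ => ?_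
    by_contra! hcon
    refine hμ ?_
    rw [spectrum.mem_resolventSet_iff, Algebra.algebraMap_eq_smul_one]
    exact hT μ hcon
  exact squeeze_zero (fun n => norm_nonneg _) (fun n => ContinuousLinearMap.le_opNorm _ _)
    (by simpa using hpow.mul_const ‖x‖)

/-- If the characteristic equation of a linear delay equation has no root in the closed right half
plane, then all its solutions tend to zero: their segments are the iterates of the step operator,
whose spectral radius is less than one. -/
theorem NoUnstableMode.tendsto_zero [FiniteDimensional ℂ E] [Nontrivial E] (hσ : 0 < σ)
    (h : NoUnstableMode A B σ) {w : ℝ → E} (hw : ContinuousOn w (Ici (-σ)))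
    (hw' : ∀ t, 0 ≤ t → HasDerivWithinAt w (A (w t) + B (w (t - σ))) (Ici 0) t) :
    Tendsto w atTop (𝓝 0) := by
  have : Nontrivial C(Icc 0 σ, E) := by
    obtain ⟨x, hx⟩ := exists_ne (0 : E)
    exact ⟨⟨ContinuousMap.const _ x, 0, fun h0 => hx (by
      simpa using congrArg (fun f : C(Icc 0 σ, E) => f ⟨0, le_rfl, hσ.le⟩) h0)⟩⟩
  set T := delayStep hσ A B
  let x : ℕ → C(Icc 0 σ, E) := fun n => ⟨fun t => w (n * σ - σ + t), by
    refine hw.comp_continuous (by fun_prop) fun t => ?_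
    have h1 : (0 : ℝ) ≤ n * σ := by positivity
    have := t.2.1
    simp only [mem_Ici]
    linarith⟩
  have hx : ∀ n t, x n t = w (n * σ - σ + t) := fun _ _ => rfl
  have hstep : ∀ n, x (n + 1) = T (x n) := by
    intro n
    have hn : (0 : ℝ) ≤ n * σ := by positivity
    ext t
    have h1 := delayStep_eq_of_hasDerivWithinAt hσ A B (x n) (v := fun s => w (n * σ + s)) ?_ ?_ ?_ t
    · rw [h1, hx]
      push_cast
      ring_nf
    · refine hw.comp (by fun_prop) fun s hs => ?_
      simp only [mem_Ici]
      linarith [hs.1]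
    · rw [hx]
      ring_nf
    · intro s hs
      have hs' : s ∈ Icc 0 σ := ⟨hs.1, hs.2.le⟩
      have h2 := (hw' (n * σ + s) (by linarith [hs.1]))
      have h3 : HasDerivWithinAt (fun s : ℝ => n * σ + s) 1 (Ici s) s :=
        ((hasDerivAt_id s).const_add _).hasDerivWithinAt
      have h4 := HasDerivWithinAt.scomp s h2 h3 fun y hy => by
        simp only [mem_Ici] at hy ⊢
        linarith [hs.1]
      rw [one_smul] at h4
      rw [IccExtend_of_mem _ _ hs', hx]
      have h5 : n * σ - σ + s = n * σ + s - σ := by ring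
      simp only [h5]
      exact h4
  have hiter : ∀ n, x n = (T ^ n) (x 0) := by
    intro n
    induction n with
    | zero => simp
    | succ n ih => rw [hstep, ih, pow_succ', mul_apply_eq_comp]
  have hxlim : Tendsto (fun n => ‖x n‖) atTop (𝓝 0) := by
    refine (tendsto_norm_pow_apply (fun μ hμ => h.isUnit_sub_delayStep hσ hμ) (x 0)).congr
      fun n => ?_
    rw [← hiter n]
  have hfloor : Tendsto (fun t : ℝ => ⌊(t + σ) / σ⌋₊) atTop atTop :=
    tendsto_nat_floor_atTop.comp ((tendsto_atTop_add_const_right _ σ tendsto_id).atTop_div_const hσ)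
  rw [tendsto_zero_iff_norm_tendsto_zero]
  refine squeeze_zero' (Eventually.of_forall fun t => norm_nonneg _) ?_ (hxlim.comp hfloor)
  filter_upwards [eventually_ge_atTop 0] with t ht
  set n := ⌊(t + σ) / σ⌋₊ with hn
  have h1 : (n : ℝ) * σ ≤ t + σ := (le_div_iff₀ hσ).1 (Nat.floor_le (by positivity))
  have h2 : t + σ < (n + 1) * σ := (div_lt_iff₀ hσ).1 (Nat.lt_floor_add_one _)
  have h3 : w t = x n ⟨t - (n * σ - σ), by constructor <;> linarith⟩ := by
    rw [hx]
    ring_nf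
  rw [h3]
  exact ContinuousMap.norm_coe_le_norm _ _

end delayOperator

/-! ### The characteristic function and stability -/

namespace Coeffs

variable {a : Coeffs} {τ : ℝ}

/-- The characteristic function of the system: its zeros are the exponents `z` of the solutions of
the form `exp (z t) v`. -/
noncomputable def charFun (a : Coeffs) (τ : ℝ) (z : ℂ) : ℂ :=
  (z - a.a11 * Complex.exp (-(z * τ))) * (z - a.a22) - a.a12 * a.a21

lemma a21_ne_zero (hb : |a.a11 * a.a22| < |a.a12 * a.a21|) : a.a21 ≠ 0 := by
  intro h
  rw [h, mul_zero, abs_zero] at hb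
  exact absurd hb (not_lt.2 (abs_nonneg _))

lemma a12_mul_a21_ne_zero (hb : |a.a11 * a.a22| < |a.a12 * a.a21|) : a.a12 * a.a21 ≠ 0 := by
  intro h
  rw [h, abs_zero] at hb
  exact absurd hb (not_lt.2 (abs_nonneg _))

/-- The real part of the solution `exp (z t) (z - a22, a21)` belonging to a characteristic root
`z`. -/
lemma exists_solution_of_charFun_eq_zero {z : ℂ} (hz : a.charFun τ z = 0) :
    ∃ r j : ℝ → ℝ, a.IsSolution τ r j ∧
      ∀ T : ℝ, ∃ t, T ≤ t ∧ |j t| = |a.a21| * Real.exp (z.re * t) := by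
  have hder : ∀ (c : ℂ) (t : ℝ), HasDerivAt (fun t : ℝ => (c * Complex.exp (z * t)).re)
      (c * (z * Complex.exp (z * t))).re t := by
    intro c t
    have h1 : HasDerivAt (fun t : ℝ => c * Complex.exp (z * t)) (c * (z * Complex.exp (z * t))) t := by
      have := (((hasDerivAt_id (t : ℂ)).const_mul z).cexp.const_mul c).comp_ofReal
      convert! this using 1
      simp only [id]
      ring
    exact Complex.reCLM.hasFDerivAt.comp_hasDerivAt t h1
  have hcont : ∀ c : ℂ, Continuous fun t : ℝ => (c * Complex.exp (z * t)).re := fun c =>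
    continuous_iff_continuousAt.2 fun t => (hder c t).continuousAt
  refine ⟨fun t => ((z - a.a22) * Complex.exp (z * t)).re,
    fun t => ((a.a21 : ℂ) * Complex.exp (z * t)).re,
    ⟨(hcont _).continuousOn, (hcont _).continuousOn, fun t _ => ?_, fun t _ => ?_⟩, fun T => ?_⟩
  · convert! (hder (z - a.a22) t).hasDerivWithinAt using 1
    rw [← Complex.re_ofReal_mul, ← Complex.re_ofReal_mul, ← Complex.add_re]
    congr 1
    have h1 : Complex.exp (z * (t - τ : ℝ)) = Complex.exp (-(z * τ)) * Complex.exp (z * t) := by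
      rw [← Complex.exp_add]
      push_cast
      ring_nf
    rw [h1]
    rw [charFun] at hz
    linear_combination (-Complex.exp (z * t)) * hz
  · convert! (hder a.a21 t).hasDerivWithinAt using 1
    rw [← Complex.re_ofReal_mul, ← Complex.re_ofReal_mul, ← Complex.add_re]
    congr 1
    ring
  · -- sample at multiples of the period, where the oscillating factor equals one
    obtain ⟨P, hP, hcos⟩ : ∃ P : ℝ, 0 < P ∧ ∀ n : ℕ, Real.cos (z.im * (n * P)) = 1 := by
      by_cases him : z.im = 0
      · exact ⟨1, one_pos, fun n => by simp [him]⟩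
      · refine ⟨2 * Real.pi / |z.im|, by positivity, fun n => ?_⟩
        have h2 : |z.im * (n * (2 * Real.pi / |z.im|))| = n * (2 * Real.pi) := by
          have := abs_pos.2 him
          rw [abs_mul, abs_mul, abs_div, abs_abs, abs_of_pos Real.two_pi_pos, Nat.abs_cast]
          field_simp
        rw [← Real.cos_abs, h2, Real.cos_nat_mul_two_pi]
    obtain ⟨n, hn⟩ := exists_nat_ge (T / P)
    refine ⟨n * P, (div_le_iff₀ hP).1 hn, ?_⟩
    change |((a.a21 : ℂ) * Complex.exp (z * ((n * P : ℝ) : ℂ))).re| = _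
    rw [Complex.re_ofReal_mul, Complex.exp_re]
    have h3 : (z * ((n * P : ℝ) : ℂ)).im = z.im * (n * P) := Complex.im_mul_ofReal _ _
    have h4 : (z * ((n * P : ℝ) : ℂ)).re = z.re * (n * P) := Complex.re_mul_ofReal _ _
    rw [h3, h4, hcos n, mul_one, abs_mul, abs_of_pos (Real.exp_pos _)]

lemma isUnstable_of_charFun_eq_zero (hb : |a.a11 * a.a22| < |a.a12 * a.a21|) {z : ℂ}
    (hz : a.charFun τ z = 0) (hre : 0 < z.re) : a.IsUnstable τ := by
  obtain ⟨r, j, hs, hj⟩ := exists_solution_of_charFun_eq_zero hz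
  refine ⟨r, j, hs, fun M => ?_⟩
  have hlim : Tendsto (fun t => |a.a21| * Real.exp (z.re * t)) atTop atTop :=
    (Real.tendsto_exp_atTop.comp (tendsto_id.const_mul_atTop hre)).const_mul_atTop
      (abs_pos.2 (a21_ne_zero hb))
  obtain ⟨T, hT⟩ := eventually_atTop.1 ((hlim.eventually_gt_atTop M).and (eventually_ge_atTop 0))
  obtain ⟨t, hTt, ht⟩ := hj T
  refine ⟨t, (hT t hTt).2, ?_⟩
  rw [ht]
  have := (hT t hTt).1
  have := abs_nonneg (r t)
  linarith

lemma IsStable.charFun_ne_zero (hb : |a.a11 * a.a22| < |a.a12 * a.a21|) (hs : a.IsStable τ)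
    {z : ℂ} (hre : 0 ≤ z.re) : a.charFun τ z ≠ 0 := by
  intro hz
  obtain ⟨r, j, hsol, hj⟩ := exists_solution_of_charFun_eq_zero hz
  have h1 := (hs r j hsol).2.abs
  rw [abs_zero] at h1
  obtain ⟨T, hT⟩ := eventually_atTop.1
    ((h1.eventually_lt_const (abs_pos.2 (a21_ne_zero hb))).and (eventually_ge_atTop 0))
  obtain ⟨t, hTt, ht⟩ := hj T
  have h2 := (hT t hTt).1
  rw [ht] at h2
  have h3 : 1 ≤ Real.exp (z.re * t) := Real.one_le_exp (mul_nonneg hre (hT t hTt).2)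
  nlinarith [abs_nonneg a.a21]

/-- The undelayed part of the system, on complex vectors. -/
noncomputable def instantPart (a : Coeffs) : ℂ × ℂ →L[ℂ] ℂ × ℂ :=
  ((a.a12 : ℂ) • ContinuousLinearMap.snd ℂ ℂ ℂ).prod
    ((a.a21 : ℂ) • ContinuousLinearMap.fst ℂ ℂ ℂ + (a.a22 : ℂ) • ContinuousLinearMap.snd ℂ ℂ ℂ)

/-- The delayed part of the system, on complex vectors. -/
noncomputable def delayedPart (a : Coeffs) : ℂ × ℂ →L[ℂ] ℂ × ℂ :=
  ((a.a11 : ℂ) • ContinuousLinearMap.fst ℂ ℂ ℂ).prod 0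

lemma instantPart_apply (v : ℂ × ℂ) :
    a.instantPart v = (a.a12 * v.2, a.a21 * v.1 + a.a22 * v.2) := by
  simp [instantPart]

lemma delayedPart_apply (v : ℂ × ℂ) : a.delayedPart v = (a.a11 * v.1, 0) := by
  simp [delayedPart]

lemma eq_zero_of_charFun_ne_zero (hb : |a.a11 * a.a22| < |a.a12 * a.a21|) {z : ℂ} {v : ℂ × ℂ}
    (hz : a.charFun τ z ≠ 0)
    (hv : a.instantPart v + Complex.exp (-(z * τ)) • a.delayedPart v = z • v) : v = 0 := by
  rw [instantPart_apply, delayedPart_apply] at hv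
  have h1 := congrArg Prod.fst hv
  have h2 := congrArg Prod.snd hv
  simp only [Prod.fst_add, Prod.snd_add, Prod.smul_fst, Prod.smul_snd, smul_eq_mul, mul_zero,
    add_zero] at h1 h2
  have hy : v.2 = 0 := by
    have h3 : a.charFun τ z * v.2 = 0 := by
      rw [charFun]
      linear_combination (-a.a21 : ℂ) * h1 - (z - a.a11 * Complex.exp (-(z * τ))) * h2
    exact (mul_eq_zero.1 h3).resolve_left hz
  have ha : (a.a21 : ℂ) ≠ 0 := by exact_mod_cast a21_ne_zero hb
  rw [hy, mul_zero, mul_zero, add_zero] at h2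
  exact Prod.ext ((mul_eq_zero.1 h2).resolve_left ha) hy

lemma IsSolution.hasDerivWithinAt_complex {r j : ℝ → ℝ} (hs : a.IsSolution τ r j) {t : ℝ}
    (ht : 0 ≤ t) : HasDerivWithinAt (fun s => ((r s : ℂ), (j s : ℂ)))
      (a.instantPart ((r t : ℂ), (j t : ℂ))
        + a.delayedPart ((r (t - τ) : ℂ), (j (t - τ) : ℂ))) (Ici 0) t := by
  rw [instantPart_apply, delayedPart_apply]
  convert! (hs.deriv_r t ht).ofReal_comp.prodMk (hs.deriv_j t ht).ofReal_comp using 1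
  ext <;> simp [add_comm]

lemma tendsto_of_tendsto_complex {r j : ℝ → ℝ}
    (h : Tendsto (fun t => ((r t : ℂ), (j t : ℂ))) atTop (𝓝 0)) :
    Tendsto r atTop (𝓝 0) ∧ Tendsto j atTop (𝓝 0) := by
  have h1 := (Complex.continuous_re.tendsto _).comp ((continuous_fst.tendsto _).comp h)
  have h2 := (Complex.continuous_re.tendsto _).comp ((continuous_snd.tendsto _).comp h)
  exact ⟨by simpa [Function.comp_def] using h1, by simpa [Function.comp_def] using h2⟩

/-- Stability from the characteristic equation. For `τ = 0` the ordinary differential equation is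
viewed as a delay equation with vanishing delayed part. -/
theorem isStable_of_charFun_ne_zero (hb : |a.a11 * a.a22| < |a.a12 * a.a21|) (hτ : 0 ≤ τ)
    (h : ∀ z : ℂ, 0 ≤ z.re → a.charFun τ z ≠ 0) : a.IsStable τ := by
  intro r j hs
  apply tendsto_of_tendsto_complex
  rcases hτ.lt_or_eq with hτ | rfl
  · have hmode : NoUnstableMode a.instantPart a.delayedPart τ := fun z v hz hv =>
      eq_zero_of_charFun_ne_zero hb (h z hz) hv
    refine hmode.tendsto_zero hτ ?_ fun t ht => hs.hasDerivWithinAt_complex ht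
    exact (Complex.continuous_ofReal.comp_continuousOn hs.continuousOn_r).prodMk
      (Complex.continuous_ofReal.comp_continuousOn hs.continuousOn_j)
  · have hmode : NoUnstableMode (a.instantPart + a.delayedPart) 0 1 := fun z v hz hv =>
      eq_zero_of_charFun_ne_zero hb (h z hz) (by simpa using hv)
    have hcont : ContinuousOn (fun t => ((r t : ℂ), (j t : ℂ))) (Ici 0) := by
      have h1 := hs.continuousOn_r
      have h2 := hs.continuousOn_j
      rw [neg_zero] at h1 h2
      exact (Complex.continuous_ofReal.comp_continuousOn h1).prodMk
        (Complex.continuous_ofReal.comp_continuousOn h2)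
    have hlim : Tendsto (fun t => ((r (max t 0) : ℂ), (j (max t 0) : ℂ))) atTop (𝓝 0) := by
      refine hmode.tendsto_zero one_pos ?_ fun t ht => ?_
      · exact hcont.comp (f := fun t => max t 0) (by fun_prop) fun t _ => le_max_right t 0
      · have h1 := hs.hasDerivWithinAt_complex ht
        have h2 : EqOn (fun t => ((r (max t 0) : ℂ), (j (max t 0) : ℂ)))
            (fun t => ((r t : ℂ), (j t : ℂ))) (Ici 0) := fun s hs => by
          simp [max_eq_left (mem_Ici.1 hs)]
        refine (h1.congr h2 (h2 ht)).congr_deriv ?_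
        simp [max_eq_left ht]
    refine hlim.congr' ?_
    filter_upwards [eventually_ge_atTop 0] with t ht
    rw [max_eq_left ht]

lemma IsStable.not_isUnstable (h : a.IsStable τ) : ¬ a.IsUnstable τ := by
  rintro ⟨r, j, hs, hM⟩
  obtain ⟨hr, hj⟩ := h r j hs
  have h2 : Tendsto (fun t => |r t| + |j t|) atTop (𝓝 0) := by
    simpa using hr.abs.add hj.abs
  obtain ⟨T, hT⟩ := eventually_atTop.1 (h2.eventually_lt_const one_pos)
  -- differentiability gives continuity on `[0, ∞)` for every sign of the delay
  have h3 : ContinuousOn (fun t => |r t| + |j t|) (Icc 0 (max T 0)) := fun t ht =>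
    (((hs.deriv_r t ht.1).continuousWithinAt.abs.add
      (hs.deriv_j t ht.1).continuousWithinAt.abs)).mono Icc_subset_Ici_self
  obtain ⟨C, hC⟩ := isCompact_Icc.exists_bound_of_continuousOn h3
  obtain ⟨t, ht, hMt⟩ := hM (max C 1)
  rcases le_total t (max T 0) with h | h
  · have := (le_abs_self _).trans (hC t ⟨ht, h⟩)
    linarith [le_max_left C 1]
  · have := hT t ((le_max_left _ _).trans h)
    linarith [le_max_right C 1]

end Coeffs

/-! ### Critical delays -/

namespace Coeffs

variable {a : Coeffs} {τ : ℝ}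

/-- The standing assumptions: they say that the equation for the squares of the frequencies of
imaginary characteristic roots has two distinct positive solutions. -/
structure HasTwoFrequencies (a : Coeffs) : Prop where
  abs_lt : |a.a11 * a.a22| < |a.a12 * a.a21|
  delta_pos : 0 < a.Delta
  sum_pos : 0 < a.a11 ^ 2 - a.a22 ^ 2 - 2 * (a.a12 * a.a21)

lemma sq_mul_lt_sq_mul (hb : |a.a11 * a.a22| < |a.a12 * a.a21|) :
    a.a11 ^ 2 * a.a22 ^ 2 < (a.a12 * a.a21) ^ 2 := by
  rw [← mul_pow]
  exact sq_lt_sq.2 hb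

lemma y_zero : a.y 0 = (a.a11 ^ 2 - a.a22 ^ 2 - 2 * (a.a12 * a.a21) - √a.Delta) / 2 := by
  simp [y, sub_eq_add_neg]

lemma y_one : a.y 1 = (a.a11 ^ 2 - a.a22 ^ 2 - 2 * (a.a12 * a.a21) + √a.Delta) / 2 := by
  simp [y]

namespace HasTwoFrequencies

variable (H : a.HasTwoFrequencies)
include H

lemma a11_ne_zero : a.a11 ≠ 0 := by
  intro h
  have h1 := H.delta_pos
  have h2 := H.sum_pos
  rw [Delta, h] at h1
  rw [h] at h2
  nlinarith [sq_nonneg a.a22]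

lemma sq_sqrt_delta : √a.Delta ^ 2 =
    (a.a11 ^ 2 + a.a22 ^ 2) ^ 2 + 4 * (a.a12 * a.a21) * (a.a22 ^ 2 - a.a11 ^ 2) :=
  Real.sq_sqrt H.delta_pos.le

lemma sqrt_delta_pos : 0 < √a.Delta := Real.sqrt_pos.2 H.delta_pos

lemma y_pos (i : Fin 2) : 0 < a.y i := by
  have h1 := H.sq_sqrt_delta
  have h2 := sq_mul_lt_sq_mul H.abs_lt
  have h3 := H.sum_pos
  have h4 := H.sqrt_delta_pos
  have h5 : √a.Delta < a.a11 ^ 2 - a.a22 ^ 2 - 2 * (a.a12 * a.a21) := by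
    refine lt_of_pow_lt_pow_left₀ 2 h3.le ?_
    nlinarith
  fin_cases i
  · change 0 < a.y 0
    rw [y_zero]; linarith
  · change 0 < a.y 1
    rw [y_one]; linarith

lemma omega_pos (i : Fin 2) : 0 < a.omega i := Real.sqrt_pos.2 (H.y_pos i)

lemma omega_sq (i : Fin 2) : a.omega i ^ 2 = a.y i := Real.sq_sqrt (H.y_pos i).le

lemma omega_lt : a.omega 0 < a.omega 1 := by
  refine Real.sqrt_lt_sqrt (H.y_pos 0).le ?_
  rw [y_zero, y_one]
  linarith [H.sqrt_delta_pos]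

lemma quadratic_eq (x : ℝ) : (x ^ 2 + a.a12 * a.a21) ^ 2 + a.a22 ^ 2 * x ^ 2
    - a.a11 ^ 2 * (x ^ 2 + a.a22 ^ 2) = (x ^ 2 - a.y 0) * (x ^ 2 - a.y 1) := by
  rw [y_zero, y_one]
  linear_combination (1 / 4 : ℝ) * H.sq_sqrt_delta

lemma omega_quadratic (i : Fin 2) :
    (a.omega i ^ 2 + a.a12 * a.a21) ^ 2 + a.a22 ^ 2 * a.omega i ^ 2
      = a.a11 ^ 2 * (a.omega i ^ 2 + a.a22 ^ 2) := by
  have h := H.quadratic_eq (a.omega i)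
  have h0 : (a.omega i ^ 2 - a.y 0) * (a.omega i ^ 2 - a.y 1) = 0 := by
    rw [H.omega_sq]
    fin_cases i <;> simp
  linarith

lemma eq_omega {x : ℝ} (hx : 0 < x) (h : (x ^ 2 + a.a12 * a.a21) ^ 2 + a.a22 ^ 2 * x ^ 2
    = a.a11 ^ 2 * (x ^ 2 + a.a22 ^ 2)) : ∃ i, x = a.omega i := by
  have h1 := H.quadratic_eq x
  rw [h, sub_self, eq_comm, mul_eq_zero, sub_eq_zero, sub_eq_zero] at h1
  rcases h1 with h1 | h1
  · exact ⟨0, by rw [omega, ← h1, Real.sqrt_sq hx.le]⟩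
  · exact ⟨1, by rw [omega, ← h1, Real.sqrt_sq hx.le]⟩

lemma denom_pos (i : Fin 2) : 0 < a.omega i ^ 2 + a.a22 ^ 2 := by
  have := H.omega_pos i
  positivity

lemma cosVal_sq_add_sinVal_sq (i : Fin 2) : a.cosVal i ^ 2 + a.sinVal i ^ 2 = 1 := by
  have h1 := H.omega_quadratic i
  have h2 := (H.denom_pos i).ne'
  have h3 := H.a11_ne_zero
  rw [cosVal, sinVal, div_pow, div_pow, ← add_div, div_eq_one_iff_eq (by positivity)]
  linear_combination (a.omega i ^ 2 + a.a22 ^ 2) * h1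

lemma abs_cosVal_le (i : Fin 2) : |a.cosVal i| ≤ 1 := by
  rw [← sq_le_one_iff_abs_le_one]
  nlinarith [H.cosVal_sq_add_sinVal_sq i, sq_nonneg (a.sinVal i)]

lemma cos_phase (i : Fin 2) : Real.cos (a.phase i) = a.cosVal i := by
  have h := abs_le.1 (H.abs_cosVal_le i)
  unfold phase
  split_ifs
  · exact Real.cos_arccos h.1 h.2
  · rw [Real.cos_two_pi_sub, Real.cos_arccos h.1 h.2]

lemma sin_phase (i : Fin 2) : Real.sin (a.phase i) = a.sinVal i := by
  have h1 : √(1 - a.cosVal i ^ 2) = |a.sinVal i| := by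
    rw [← Real.sqrt_sq_eq_abs]
    congr 1
    linarith [H.cosVal_sq_add_sinVal_sq i]
  unfold phase
  split_ifs with hs
  · rw [Real.sin_arccos, h1, abs_of_nonneg hs]
  · rw [Real.sin_two_pi_sub, Real.sin_arccos, h1, abs_of_neg (not_le.1 hs), neg_neg]

omit H in
lemma phase_nonneg (a : Coeffs) (i : Fin 2) : 0 ≤ a.phase i := by
  have h1 := Real.arccos_nonneg (a.cosVal i)
  have h2 := Real.arccos_le_pi (a.cosVal i)
  have := Real.pi_pos
  unfold phase
  split_ifs <;> linarith

lemma phase_lt (i : Fin 2) : a.phase i < 2 * Real.pi := by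
  have h2 := Real.arccos_le_pi (a.cosVal i)
  have := Real.pi_pos
  unfold phase
  split_ifs with hs
  · linarith
  · have h3 : 0 < Real.arccos (a.cosVal i) := by
      rw [Real.arccos_pos]
      have := H.cosVal_sq_add_sinVal_sq i
      have := not_le.1 hs
      nlinarith
    linarith

lemma critDelay_eq_iff (i : Fin 2) (k : ℕ) :
    τ = a.critDelay i k ↔ a.omega i * τ = a.phase i + k * (2 * Real.pi) := by
  have := (H.omega_pos i).ne'
  rw [critDelay, ← add_div, eq_div_iff this, mul_comm τ]
  constructor <;> intro h <;> linarith

lemma omega_mul_critDelay (i : Fin 2) (k : ℕ) :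
    a.omega i * a.critDelay i k = a.phase i + k * (2 * Real.pi) :=
  (H.critDelay_eq_iff i k).1 rfl

lemma critDelay_nonneg (i : Fin 2) (k : ℕ) : 0 ≤ a.critDelay i k := by
  have h1 := H.omega_mul_critDelay i k
  have h2 := phase_nonneg a i
  have h3 : (0 : ℝ) ≤ k * (2 * Real.pi) := by positivity
  exact nonneg_of_mul_nonneg_right (by linarith) (H.omega_pos i)

lemma critDelay_strictMono (i : Fin 2) : StrictMono (a.critDelay i) := by
  refine strictMono_nat_of_lt_succ fun k => ?_
  refine lt_of_mul_lt_mul_left ?_ (H.omega_pos i).le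
  rw [H.omega_mul_critDelay, H.omega_mul_critDelay]
  push_cast
  linarith [Real.pi_pos]

lemma critDelay_tendsto (i : Fin 2) : Tendsto (a.critDelay i) atTop atTop := by
  have h1 : a.critDelay i = fun k : ℕ => a.phase i / a.omega i + k * (2 * Real.pi / a.omega i) := by
    funext k
    rw [critDelay]
    ring
  rw [h1]
  have := H.omega_pos i
  exact tendsto_atTop_add_const_left _ _
    (tendsto_natCast_atTop_atTop.atTop_mul_const (by positivity))

lemma exists_critDelay_iff (hτ : 0 ≤ τ) (i : Fin 2) :
    (∃ k, τ = a.critDelay i k) ↔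
      Real.cos (a.omega i * τ) = a.cosVal i ∧ Real.sin (a.omega i * τ) = a.sinVal i := by
  constructor
  · rintro ⟨k, hk⟩
    rw [H.critDelay_eq_iff] at hk
    rw [hk, Real.cos_add_nat_mul_two_pi, Real.sin_add_nat_mul_two_pi]
    exact ⟨H.cos_phase i, H.sin_phase i⟩
  · rintro ⟨h1, h2⟩
    rw [← H.cos_phase i] at h1
    rw [← H.sin_phase i] at h2
    obtain ⟨n, hn⟩ := Real.Angle.angle_eq_iff_two_pi_dvd_sub.1 (Real.Angle.cos_sin_inj h1 h2)
    have hn0 : 0 ≤ n := by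
      by_contra! hneg
      have h3 : (n : ℝ) ≤ -1 := by exact_mod_cast (by omega : n ≤ -1)
      have h4 := H.phase_lt i
      have h5 := mul_nonneg (H.omega_pos i).le hτ
      nlinarith [Real.pi_pos]
    obtain ⟨k, rfl⟩ := Int.eq_ofNat_of_zero_le hn0
    refine ⟨k, (H.critDelay_eq_iff i k).2 ?_⟩
    push_cast at hn
    linarith

end HasTwoFrequencies

lemma charFun_conj (z : ℂ) :
    a.charFun τ ((starRingEnd ℂ) z) = (starRingEnd ℂ) (a.charFun τ z) := by
  simp [charFun, ← Complex.exp_conj]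

lemma charFun_zero_ne_zero (hb : |a.a11 * a.a22| < |a.a12 * a.a21|) : a.charFun τ 0 ≠ 0 := by
  intro h
  have h1 : ((a.a11 * a.a22 - a.a12 * a.a21 : ℝ) : ℂ) = 0 := by
    rw [← h, charFun]
    push_cast
    simp
  have h2 : a.a11 * a.a22 - a.a12 * a.a21 = 0 := by exact_mod_cast h1
  rw [sub_eq_zero.1 h2] at hb
  exact lt_irrefl _ hb

/-- Real and imaginary part of the characteristic equation on the imaginary axis. -/
lemma charFun_mul_I_eq_zero_iff (x : ℝ) : a.charFun τ (x * Complex.I) = 0 ↔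
    a.a11 * (x * Real.sin (x * τ) - a.a22 * Real.cos (x * τ)) = -(x ^ 2 + a.a12 * a.a21) ∧
    a.a11 * (x * Real.cos (x * τ) + a.a22 * Real.sin (x * τ)) = -(a.a22 * x) := by
  have h1 : Complex.exp (-(x * Complex.I * τ))
      = (Real.cos (x * τ) : ℂ) - Real.sin (x * τ) * Complex.I := by
    have : -(x * Complex.I * τ) = ((-(x * τ) : ℝ) : ℂ) * Complex.I := by push_cast; ring
    rw [this, Complex.exp_mul_I, ← Complex.ofReal_cos, ← Complex.ofReal_sin, Real.cos_neg,
      Real.sin_neg]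
    push_cast
    ring
  rw [charFun, h1, Complex.ext_iff]
  simp only [Complex.sub_re, Complex.mul_re, Complex.ofReal_re, Complex.I_re, mul_zero,
    Complex.ofReal_im, Complex.I_im, mul_one, Complex.sub_im, Complex.mul_im, Complex.zero_re,
    Complex.zero_im, zero_mul, add_zero, sub_zero, zero_sub]
  constructor
  · rintro ⟨h2, h3⟩
    constructor <;> linarith
  · rintro ⟨h2, h3⟩
    constructor <;> linarith

namespace HasTwoFrequencies

variable (H : a.HasTwoFrequencies)
include H

lemma charFun_mul_I_eq_zero_iff_exists {x : ℝ} (hx : 0 < x) (hτ : 0 ≤ τ) :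
    a.charFun τ (x * Complex.I) = 0 ↔ ∃ i k, x = a.omega i ∧ τ = a.critDelay i k := by
  have hp := H.a11_ne_zero
  rw [charFun_mul_I_eq_zero_iff]
  constructor
  · rintro ⟨h1, h2⟩
    have h3 := Real.sin_sq_add_cos_sq (x * τ)
    have h4 : (x ^ 2 + a.a12 * a.a21) ^ 2 + a.a22 ^ 2 * x ^ 2
        = a.a11 ^ 2 * (x ^ 2 + a.a22 ^ 2) := by
      linear_combination (a.a11 ^ 2 * (x ^ 2 + a.a22 ^ 2)) * h3
        - (a.a11 * (x * Real.sin (x * τ) - a.a22 * Real.cos (x * τ))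
          - (x ^ 2 + a.a12 * a.a21)) * h1
        - (a.a11 * (x * Real.cos (x * τ) + a.a22 * Real.sin (x * τ)) - a.a22 * x) * h2
    obtain ⟨i, rfl⟩ := H.eq_omega hx h4
    have h5 := (H.denom_pos i).ne'
    obtain ⟨k, hk⟩ := (H.exists_critDelay_iff hτ i).2 ⟨by
        rw [cosVal, eq_div_iff (mul_ne_zero hp h5)]
        linear_combination a.omega i * h2 - a.a22 * h1, by
        rw [sinVal, eq_div_iff (mul_ne_zero hp h5)]
        linear_combination a.omega i * h1 + a.a22 * h2⟩
    exact ⟨i, k, rfl, hk⟩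
  · rintro ⟨i, k, rfl, hk⟩
    obtain ⟨h1, h2⟩ := (H.exists_critDelay_iff hτ i).1 ⟨k, hk⟩
    have h5 := (H.denom_pos i).ne'
    rw [h1, h2, cosVal, sinVal]
    constructor
    · field_simp
      ring
    · field_simp
      ring

/-- For nonnegative delays, imaginary characteristic roots occur exactly at the critical delays. -/
lemma charFun_eq_zero_iff_of_re_eq_zero {z : ℂ} (hz : z.re = 0) (hτ : 0 ≤ τ) :
    a.charFun τ z = 0 ↔ ∃ i k, τ = a.critDelay i k ∧
      (z = a.omega i * Complex.I ∨ z = -(a.omega i * Complex.I)) := by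
  have hzI : z = z.im * Complex.I := by
    apply Complex.ext <;> simp [hz]
  have hneg : ∀ x : ℝ, a.charFun τ ((-x : ℝ) * Complex.I) = 0 ↔ a.charFun τ (x * Complex.I) = 0 := by
    intro x
    have h1 : ((-x : ℝ) : ℂ) * Complex.I = (starRingEnd ℂ) (x * Complex.I) := by simp
    rw [h1, charFun_conj, map_eq_zero]
  rcases lt_trichotomy z.im 0 with him | him | him
  · have h1 := H.charFun_mul_I_eq_zero_iff_exists (neg_pos.2 him) hτ
    rw [hneg, ← hzI] at h1
    rw [h1]
    refine exists_congr fun i => exists_congr fun k => ?_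
    rw [and_comm]
    refine and_congr_right fun _ => ?_
    constructor
    · intro h
      right
      rw [hzI, ← h]
      simp
    · rintro (h | h)
      · have := congrArg Complex.im h
        simp at this
        linarith [H.omega_pos i]
      · have := congrArg Complex.im h
        simp at this
        linarith
  · have h0 : z = 0 := by rw [hzI, him]; simp
    refine ⟨fun h => absurd (h0 ▸ h) (charFun_zero_ne_zero H.abs_lt), ?_⟩
    rintro ⟨i, k, -, h | h⟩
    all_goals
      have := congrArg Complex.im h
      simp only [him, Complex.neg_im, Complex.mul_im, Complex.ofReal_re, Complex.ofReal_im,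
        Complex.I_re, Complex.I_im, mul_one, mul_zero, add_zero] at this
      linarith [H.omega_pos i]
  · have h1 := H.charFun_mul_I_eq_zero_iff_exists him hτ
    rw [← hzI] at h1
    rw [h1]
    refine exists_congr fun i => exists_congr fun k => ?_
    rw [and_comm]
    refine and_congr_right fun _ => ?_
    constructor
    · intro h
      left
      rw [hzI, ← h]
    · rintro (h | h)
      · have := congrArg Complex.im h
        simpa using this
      · have := congrArg Complex.im h
        simp at this
        linarith [H.omega_pos i]

end HasTwoFrequencies

end Coeffs

/-! ### Motion of the characteristic roots -/

namespace Coeffs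

variable {a : Coeffs} {τ : ℝ}

lemma differentiable_charFun (a : Coeffs) (τ : ℝ) : Differentiable ℂ (a.charFun τ) := by
  unfold charFun
  fun_prop

lemma continuous_charFun (a : Coeffs) : Continuous fun q : ℝ × ℂ => a.charFun q.1 q.2 := by
  unfold charFun
  fun_prop

/-- A common bound for the characteristic roots in the closed right half plane, for all
nonnegative delays. -/
lemma norm_le_of_charFun_eq_zero (hτ : 0 ≤ τ) {z : ℂ} (hre : 0 ≤ z.re)
    (hz : a.charFun τ z = 0) : ‖z‖ ≤ |a.a11| + |a.a22| + |a.a12 * a.a21| + 1 := by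
  by_contra! hcon
  have he : ‖Complex.exp (-(z * τ))‖ ≤ 1 := by
    rw [Complex.norm_exp, Real.exp_le_one_iff]
    simp only [Complex.neg_re, Complex.mul_re, Complex.ofReal_re, Complex.ofReal_im, mul_zero,
      sub_zero]
    have := mul_nonneg hre hτ
    linarith
  have h0 := abs_nonneg (a.a12 * a.a21)
  have h1 : |a.a12 * a.a21| + 1 ≤ ‖z - a.a11 * Complex.exp (-(z * τ))‖ := by
    have h2 := norm_sub_norm_le z (a.a11 * Complex.exp (-(z * τ)))
    rw [norm_mul, Complex.norm_real, Real.norm_eq_abs] at h2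
    have h3 := mul_le_mul_of_nonneg_left he (abs_nonneg a.a11)
    have := abs_nonneg a.a22
    linarith
  have h4 : 1 ≤ ‖z - a.a22‖ := by
    have h2 := norm_sub_norm_le z a.a22
    rw [Complex.norm_real, Real.norm_eq_abs] at h2
    have := abs_nonneg a.a11
    linarith
  have h5 : ‖(z - a.a11 * Complex.exp (-(z * τ))) * (z - a.a22)‖ = |a.a12 * a.a21| := by
    rw [charFun, sub_eq_zero] at hz
    rw [hz, ← Complex.ofReal_mul, Complex.norm_real, Real.norm_eq_abs]
  rw [norm_mul] at h5
  nlinarith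

lemma finite_charFun_zeros (hb : |a.a11 * a.a22| < |a.a12 * a.a21|) (hτ : 0 ≤ τ) {U : Set ℂ}
    (hU : ∀ z ∈ U, 0 ≤ z.re) : (U ∩ {z | a.charFun τ z = 0}).Finite := by
  refine (finite_zeros_of_isBounded (a.differentiable_charFun τ) (charFun_zero_ne_zero hb)
    (Metric.isBounded_closedBall (x := (0 : ℂ))
      (r := |a.a11| + |a.a22| + |a.a12 * a.a21| + 1))).subset ?_
  rintro z ⟨hzU, hz⟩
  exact ⟨by simpa using norm_le_of_charFun_eq_zero hτ (hU z hzU) hz, hz⟩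

/-- The number of unstable characteristic roots, counted with multiplicity. -/
noncomputable def unstableCount (a : Coeffs) (τ : ℝ) : ℕ := zeroCount (a.charFun τ) {z | 0 < z.re}

lemma unstableCount_pos_iff (hb : |a.a11 * a.a22| < |a.a12 * a.a21|) (hτ : 0 ≤ τ) :
    0 < a.unstableCount τ ↔ ∃ z : ℂ, 0 < z.re ∧ a.charFun τ z = 0 :=
  zeroCount_pos_iff (a.differentiable_charFun τ) (charFun_zero_ne_zero hb)
    (finite_charFun_zeros hb hτ fun _ hz => le_of_lt hz)

/-- The partial derivative of the characteristic function in the space variable. -/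
noncomputable def charFunDeriv (a : Coeffs) (τ : ℝ) (z : ℂ) : ℂ :=
  (1 + τ * (a.a11 * Complex.exp (-(z * τ)))) * (z - a.a22) + (z - a.a11 * Complex.exp (-(z * τ)))

/-- The partial derivative of the characteristic function in the delay. -/
noncomputable def charFunDelayDeriv (a : Coeffs) (τ : ℝ) (z : ℂ) : ℂ :=
  z * (a.a11 * Complex.exp (-(z * τ))) * (z - a.a22)

lemma hasFDerivAt_charFun (a : Coeffs) (τ : ℝ) (z : ℂ) :
    HasFDerivAt (𝕜 := ℝ) (fun q : ℝ × ℂ => a.charFun q.1 q.2)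
      ((ContinuousLinearMap.fst ℝ ℝ ℂ).smulRight (a.charFunDelayDeriv τ z) +
        (ContinuousLinearMap.mul ℝ ℂ (a.charFunDeriv τ z)).comp (ContinuousLinearMap.snd ℝ ℝ ℂ))
      (τ, z) := by
  have h1 : HasFDerivAt (𝕜 := ℝ) (fun q : ℝ × ℂ => q.2) (ContinuousLinearMap.snd ℝ ℝ ℂ) (τ, z) :=
    hasFDerivAt_snd
  have h2 : HasFDerivAt (𝕜 := ℝ) (fun q : ℝ × ℂ => (q.1 : ℂ))
      (Complex.ofRealCLM.comp (ContinuousLinearMap.fst ℝ ℝ ℂ)) (τ, z) :=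
    Complex.ofRealCLM.hasFDerivAt.comp (τ, z) hasFDerivAt_fst
  have h3 := ((h1.sub ((h1.mul h2).neg.cexp.const_mul (a.a11 : ℂ))).mul
    (h1.sub_const (a.a22 : ℂ))).sub_const ((a.a12 : ℂ) * a.a21)
  refine (h3.congr_fderiv ?_)
  ext
  · simp [charFunDelayDeriv]
    ring
  · simp [charFunDeriv, charFunDelayDeriv]
    ring

lemma hasDerivAt_charFun (a : Coeffs) (τ : ℝ) (z : ℂ) :
    HasDerivAt (a.charFun τ) (a.charFunDeriv τ z) z := by
  have h1 := hasDerivAt_id z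
  have h3 := ((h1.sub ((h1.mul_const (τ : ℂ)).neg.cexp.const_mul (a.a11 : ℂ))).mul
    (h1.sub_const (a.a22 : ℂ))).sub_const ((a.a12 : ℂ) * a.a21)
  convert! h3 using 1
  simp only [charFunDeriv, id, Pi.neg_apply, Pi.sub_apply]
  ring

/-- The crossing direction at an imaginary characteristic root: the real velocity of the root has
the sign of the derivative of the quadratic polynomial that determines the squares of the
frequencies. -/
lemma re_charFunDelayDeriv_mul_conj {x : ℝ} (hx : a.charFun τ (x * Complex.I) = 0) :
    (-(a.charFunDelayDeriv τ (x * Complex.I) *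
      (starRingEnd ℂ) (a.charFunDeriv τ (x * Complex.I)))).re
      = x ^ 2 * (2 * x ^ 2 + 2 * (a.a12 * a.a21) + a.a22 ^ 2 - a.a11 ^ 2) := by
  obtain ⟨h1, h2⟩ := (charFun_mul_I_eq_zero_iff x).1 hx
  have h3 := Real.sin_sq_add_cos_sq (x * τ)
  have he : Complex.exp (-(x * Complex.I * τ))
      = (Real.cos (x * τ) : ℂ) - Real.sin (x * τ) * Complex.I := by
    have : -(x * Complex.I * τ) = ((-(x * τ) : ℝ) : ℂ) * Complex.I := by push_cast; ring
    rw [this, Complex.exp_mul_I, ← Complex.ofReal_cos, ← Complex.ofReal_sin, Real.cos_neg,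
      Real.sin_neg]
    push_cast
    ring
  have hW : (a.a11 : ℂ) * Complex.exp (-(x * Complex.I * τ)) * (x * Complex.I - a.a22)
      = x * Complex.I * (x * Complex.I - a.a22) - a.a12 * a.a21 := by
    rw [charFun] at hx
    linear_combination -hx
  have hA : a.charFunDeriv τ (x * Complex.I)
      = ((-a.a22 - τ * (x ^ 2 + a.a12 * a.a21) - a.a11 * Real.cos (x * τ) : ℝ) : ℂ)
        + ((2 * x - τ * (a.a22 * x) + a.a11 * Real.sin (x * τ) : ℝ) : ℂ) * Complex.I := by
    have : a.charFunDeriv τ (x * Complex.I) = (x * Complex.I - a.a22)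
        + τ * (a.a11 * Complex.exp (-(x * Complex.I * τ)) * (x * Complex.I - a.a22))
        + (x * Complex.I - a.a11 * Complex.exp (-(x * Complex.I * τ))) := by
      rw [charFunDeriv]; ring
    rw [this, hW, he]
    push_cast
    linear_combination (τ * x ^ 2 : ℂ) * Complex.I_sq
  have hB : a.charFunDelayDeriv τ (x * Complex.I)
      = ((a.a22 * x ^ 2 : ℝ) : ℂ) + ((-(x * (x ^ 2 + a.a12 * a.a21)) : ℝ) : ℂ) * Complex.I := by
    rw [charFunDelayDeriv, mul_assoc, hW]
    push_cast
    linear_combination (x ^ 3 * Complex.I - a.a22 * x ^ 2 : ℂ) * Complex.I_sq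
  rw [hA, hB]
  simp only [map_add, map_mul, Complex.conj_ofReal, Complex.conj_I, Complex.neg_re,
    Complex.mul_re, Complex.add_re, Complex.add_im, Complex.mul_im, Complex.ofReal_re,
    Complex.ofReal_im, Complex.I_re, Complex.I_im, Complex.neg_im, mul_zero, mul_one, sub_zero,
    add_zero, zero_add, mul_neg, neg_zero]
  linear_combination (-(a.a11 ^ 2 * x ^ 2)) * h3
    + (x * a.a11 * Real.sin (x * τ)) * h1 + (x * a.a11 * Real.cos (x * τ)) * h2

namespace HasTwoFrequencies

variable (H : a.HasTwoFrequencies)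
include H

lemma omega_injective : Function.Injective a.omega := fun i j h =>
  match i, j, h with
  | 0, 0, _ => rfl
  | 0, 1, h => absurd h H.omega_lt.ne
  | 1, 0, h => absurd h H.omega_lt.ne'
  | 1, 1, _ => rfl

lemma two_mul_omega_sq_zero :
    2 * a.omega 0 ^ 2 + 2 * (a.a12 * a.a21) + a.a22 ^ 2 - a.a11 ^ 2 = -√a.Delta := by
  rw [H.omega_sq, y_zero]
  ring

lemma two_mul_omega_sq_one :
    2 * a.omega 1 ^ 2 + 2 * (a.a12 * a.a21) + a.a22 ^ 2 - a.a11 ^ 2 = √a.Delta := by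
  rw [H.omega_sq, y_one]
  ring

/-- The roots with the larger frequency cross the imaginary axis to the right and those with the
smaller one to the left. The hypotheses say that, on the side `l` of the delay `τ₀`, the roots of
index `i` are in the right half plane and those of the other index are not. -/
lemma eventually_unstableCount_eq {τ₀ : ℝ} (hτ₀ : 0 ≤ τ₀) {l : Filter ℝ} (hl : l ≤ 𝓝[≠] τ₀)
    (hl0 : ∀ᶠ t in l, 0 ≤ t) (i : Fin 2)
    (hi : ∀ j, ∀ᶠ t in l, if j = i then
      0 < (2 * a.omega j ^ 2 + 2 * (a.a12 * a.a21) + a.a22 ^ 2 - a.a11 ^ 2) * (t - τ₀)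
      else (2 * a.omega j ^ 2 + 2 * (a.a12 * a.a21) + a.a22 ^ 2 - a.a11 ^ 2) * (t - τ₀) < 0) :
    ∀ᶠ t in l, (a.unstableCount t : ℤ)
      = a.unstableCount τ₀ + 2 * (range (a.critDelay i)).indicator 1 τ₀ := by
  classical
  set K : Set ℂ := Metric.closedBall 0 (|a.a11| + |a.a22| + |a.a12 * a.a21| + 1) ∩ {z | 0 ≤ z.re}
  have hK : IsCompact K := (isCompact_closedBall _ _).inter_right
    (isClosed_le continuous_const Complex.continuous_re)
  have hfin : (K ∩ {z | a.charFun τ₀ z = 0}).Finite :=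
    finite_charFun_zeros H.abs_lt hτ₀ fun z hz => hz.2
  set Z := hfin.toFinset
  have hZ : ∀ z, z ∈ Z ↔ 0 ≤ z.re ∧ a.charFun τ₀ z = 0 := by
    intro z
    simp only [Z, Finite.mem_toFinset]
    refine ⟨fun h => ⟨h.1.2, h.2⟩, fun h => ⟨⟨?_, h.1⟩, h.2⟩⟩
    simpa using norm_le_of_charFun_eq_zero hτ₀ h.1 h.2
  set P : ℂ → Prop := fun z => z = a.omega i * Complex.I ∨ z = -(a.omega i * Complex.I)
  set m : ℂ → ℕ := fun z => (if 0 < z.re then analyticOrderNatAt (a.charFun τ₀) z else 0)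
    + if P z then 1 else 0
  have hPre : ∀ z, P z → z.re = 0 := by
    rintro z (rfl | rfl) <;> simp
  have hF := a.continuous_charFun
  have hd := a.differentiable_charFun
  have hw := charFun_zero_ne_zero (τ := τ₀) H.abs_lt
  have hlow : l ≤ 𝓝 τ₀ := hl.trans nhdsWithin_le_nhds
  have hmain : ∀ᶠ t in l, a.unstableCount t = ∑ s ∈ Z, m s := by
    refine eventually_zeroCount_eq_sum hF hd hlow hw hK ?_ Z
      (fun z hz h0 => (hZ z).2 ⟨hz.2, h0⟩) m fun s hs => ?_
    · filter_upwards [hl0] with t ht z hz h0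
      exact ⟨by simpa using norm_le_of_charFun_eq_zero ht (le_of_lt hz) h0, le_of_lt hz⟩
    · obtain ⟨hsre, hs0⟩ := (hZ s).1 hs
      rcases hsre.lt_or_eq with hpos | hzero
      · have hm : m s = analyticOrderNatAt (a.charFun τ₀) s := by
          have : ¬ P s := fun hP => hpos.ne' (hPre s hP)
          simp [m, hpos, this]
        have hU : {z : ℂ | 0 < z.re} ∈ 𝓝 s :=
          (isOpen_lt continuous_const Complex.continuous_re).mem_nhds hpos
        obtain ⟨δ, hδ, hδU⟩ := Metric.mem_nhds_iff.1 hU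
        filter_upwards [eventually_zeroCount_small_ball hF hd hw s, Ioo_mem_nhdsGT hδ]
          with ε hε hεδ
        rw [inter_eq_self_of_subset_left ((Metric.ball_subset_ball hεδ.2.le).trans hδU), hm]
        exact hlow hε
      · obtain ⟨j, k, -, hsj⟩ := (H.charFun_eq_zero_iff_of_re_eq_zero hzero.symm hτ₀).1 hs0
        obtain ⟨x, hx, hsx⟩ : ∃ x : ℝ, x ^ 2 = a.omega j ^ 2 ∧ s = x * Complex.I := by
          rcases hsj with h | h
          · exact ⟨a.omega j, rfl, h⟩
          · exact ⟨-a.omega j, by ring, by rw [h]; push_cast; ring⟩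
        have hDval := re_charFunDelayDeriv_mul_conj (hsx ▸ hs0)
        rw [← hsx, hx] at hDval
        set G := 2 * a.omega j ^ 2 + 2 * (a.a12 * a.a21) + a.a22 ^ 2 - a.a11 ^ 2 with hG
        have hG0 : G ≠ 0 := by
          have := H.sqrt_delta_pos
          fin_cases j
          · exact (H.two_mul_omega_sq_zero.trans_lt (by linarith)).ne
          · exact (this.trans_eq H.two_mul_omega_sq_one.symm).ne'
        have hom : 0 < a.omega j ^ 2 := pow_pos (H.omega_pos j) 2
        have hD0 : a.omega j ^ 2 * G ≠ 0 := mul_ne_zero hom.ne' hG0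
        have hA0 : a.charFunDeriv τ₀ s ≠ 0 := by
          intro h
          rw [h] at hDval
          simp only [map_zero, mul_zero, neg_zero, Complex.zero_re] at hDval
          exact hD0 hDval.symm
        have hord : analyticOrderNatAt (a.charFun τ₀) s = 1 := by
          rw [analyticOrderNatAt, AnalyticAt.analyticOrderAt_eq_one_of_zero_deriv_ne_zero
            ((hd τ₀).analyticAt s) hs0 (by rwa [(hasDerivAt_charFun a τ₀ s).deriv])]
          rfl
        have hsign := eventually_re_sign_of_zero hzero.symm hs0 (hasFDerivAt_charFun a τ₀ s)
          (by rwa [hDval])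
        rw [hDval] at hsign
        have hPiff : P s ↔ j = i := by
          have h1 : P s ↔ s.im ^ 2 = a.omega i ^ 2 := by
            rw [sq_eq_sq_iff_eq_or_eq_neg]
            simp only [P]
            rw [Complex.ext_iff, Complex.ext_iff]
            simp [← hzero]
          have h2 : s.im = x := by rw [hsx]; simp
          rw [h1, h2, hx]
          constructor
          · intro h
            exact H.omega_injective
              ((pow_left_inj₀ (H.omega_pos j).le (H.omega_pos i).le two_ne_zero).1 h)
          · rintro rfl
            rfl
        refine eventually_zeroCount_crossing hF hd hl hw hord hsign (m s) ?_
        have hi' := hi j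
        by_cases hji : j = i
        · left
          refine ⟨by simp [m, ← hzero, hPiff.2 hji], ?_⟩
          filter_upwards [hi'] with t ht
          rw [if_pos hji] at ht
          rw [mul_assoc]
          exact mul_pos hom ht
        · right
          refine ⟨by simp [m, ← hzero, mt hPiff.1 hji], ?_⟩
          filter_upwards [hi'] with t ht
          rw [if_neg hji] at ht
          rw [mul_assoc]
          exact mul_neg_of_pos_of_neg hom ht
  have hinner : a.unstableCount τ₀
      = ∑ s ∈ Z, if 0 < s.re then analyticOrderNatAt (a.charFun τ₀) s else 0 := by
    rw [← Finset.sum_filter, unstableCount, zeroCount_congr_set (V := (Z.filter fun s => 0 < s.re : Finset ℂ)),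
      zeroCount, finsum_mem_coe_finset]
    intro z hz
    have : z ∈ Z ↔ 0 ≤ z.re := by simp [hZ, hz]
    simp only [mem_ofPred_eq, Finset.coe_filter, this]
    exact ⟨fun h => ⟨h.le, h⟩, fun h => h.2⟩
  have houter : ((∑ s ∈ Z, if P s then 1 else 0 : ℕ) : ℤ)
      = 2 * (range (a.critDelay i)).indicator 1 τ₀ := by
    have hom := (H.omega_pos i).ne'
    rw [← Finset.sum_filter, Finset.sum_const, smul_eq_mul, mul_one]
    have hzero : ∀ z, P z → (a.charFun τ₀ z = 0 ↔ τ₀ ∈ range (a.critDelay i)) := by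
      intro z hz
      have h1 : a.charFun τ₀ (a.omega i * Complex.I) = 0 ↔ ∃ k, τ₀ = a.critDelay i k := by
        rw [H.charFun_mul_I_eq_zero_iff_exists (H.omega_pos i) hτ₀]
        constructor
        · rintro ⟨j, k, hj, hk⟩
          exact ⟨k, (H.omega_injective hj).symm ▸ hk⟩
        · rintro ⟨k, hk⟩
          exact ⟨i, k, rfl, hk⟩
      have h2 : a.charFun τ₀ z = 0 ↔ a.charFun τ₀ (a.omega i * Complex.I) = 0 := by
        rcases hz with rfl | rfl
        · rfl
        · have h3 : -(a.omega i * Complex.I) = (starRingEnd ℂ) (a.omega i * Complex.I) := by simp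
          rw [h3, charFun_conj, map_eq_zero]
      rw [h2, h1, mem_range]
      exact exists_congr fun k => eq_comm
    by_cases hmem : τ₀ ∈ range (a.critDelay i)
    · rw [indicator_of_mem hmem]
      have : Z.filter P = {(a.omega i * Complex.I : ℂ), -(a.omega i * Complex.I)} := by
        ext z
        simp only [Finset.mem_filter, hZ, Finset.mem_insert, Finset.mem_singleton]
        exact ⟨fun h => h.2, fun h => ⟨⟨(hPre z h).ge, (hzero z h).2 hmem⟩, h⟩⟩
      rw [this, Finset.card_pair]
      · rfl
      · intro h
        have := congrArg Complex.im h
        simp at this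
        exact hom (by linarith)
    · rw [indicator_of_notMem hmem]
      have : Z.filter P = ∅ := by
        ext z
        simp only [Finset.mem_filter, hZ, Finset.notMem_empty, iff_false]
        exact fun h => hmem ((hzero z h.2).1 h.1.2)
      rw [this]
      rfl
  filter_upwards [hmain] with t ht
  rw [ht, ← houter, hinner, ← Nat.cast_add, ← Finset.sum_add_distrib]

lemma eventually_unstableCount_right {τ₀ : ℝ} (hτ₀ : 0 ≤ τ₀) :
    ∀ᶠ t in 𝓝[>] τ₀, (a.unstableCount t : ℤ)
      = a.unstableCount τ₀ + 2 * (range (a.critDelay 1)).indicator 1 τ₀ := by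
  have hlt : ∀ᶠ t in 𝓝[>] τ₀, τ₀ < t := self_mem_nhdsWithin
  refine H.eventually_unstableCount_eq hτ₀ (nhdsWithin_mono _ fun t ht => ne_of_gt ht)
    (hlt.mono fun t ht => hτ₀.trans ht.le) 1
    (Fin.forall_fin_two.2 ⟨?_, ?_⟩) <;> filter_upwards [hlt] with t ht
  · rw [if_neg (by decide)]
    rw [H.two_mul_omega_sq_zero]
    nlinarith [H.sqrt_delta_pos]
  · rw [if_pos rfl]
    rw [H.two_mul_omega_sq_one]
    nlinarith [H.sqrt_delta_pos]

lemma eventually_unstableCount_left {τ₀ : ℝ} (hτ₀ : 0 < τ₀) :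
    ∀ᶠ t in 𝓝[<] τ₀, (a.unstableCount t : ℤ)
      = a.unstableCount τ₀ + 2 * (range (a.critDelay 0)).indicator 1 τ₀ := by
  have hlt : ∀ᶠ t in 𝓝[<] τ₀, t < τ₀ := self_mem_nhdsWithin
  refine H.eventually_unstableCount_eq hτ₀.le (nhdsWithin_mono _ fun t ht => ne_of_lt ht)
    (nhdsWithin_le_nhds (Ici_mem_nhds hτ₀)) 0
    (Fin.forall_fin_two.2 ⟨?_, ?_⟩) <;> filter_upwards [hlt] with t ht
  · rw [if_pos rfl]
    rw [H.two_mul_omega_sq_zero]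
    nlinarith [H.sqrt_delta_pos]
  · rw [if_neg (by decide)]
    rw [H.two_mul_omega_sq_one]
    nlinarith [H.sqrt_delta_pos]

end HasTwoFrequencies

end Coeffs

/-! ### Counting functions of two interlacing sequences -/

section interlacing

/-- For an increasing sequence `s`, the number of terms less than `x`. -/
noncomputable def countLT (s : ℕ → ℝ) (x : ℝ) : ℕ := sInf {k | x ≤ s k}

/-- For an increasing sequence `s`, the number of terms less than or equal to `x`. -/
noncomputable def countLE (s : ℕ → ℝ) (x : ℝ) : ℕ := sInf {k | x < s k}

variable {s s₀ s₁ : ℕ → ℝ} {x : ℝ}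

lemma lt_countLT (hs : StrictMono s) (ht : Tendsto s atTop atTop) {k : ℕ} :
    k < countLT s x ↔ s k < x := by
  constructor
  · intro h
    exact not_le.1 (Nat.notMem_of_lt_sInf h)
  · intro h
    by_contra! hcon
    have hne : {k | x ≤ s k}.Nonempty := (ht.eventually_ge_atTop x).exists
    exact absurd ((Nat.sInf_mem hne).trans (hs.monotone hcon)) (not_le.2 h)

lemma lt_countLE (hs : StrictMono s) (ht : Tendsto s atTop atTop) {k : ℕ} :
    k < countLE s x ↔ s k ≤ x := by
  constructor
  · intro h
    exact not_lt.1 (Nat.notMem_of_lt_sInf h)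
  · intro h
    by_contra! hcon
    have hne : {k | x < s k}.Nonempty := (ht.eventually_gt_atTop x).exists
    have h1 : x < s (countLE s x) := Nat.sInf_mem hne
    exact absurd (h1.trans_le (hs.monotone hcon)) (not_lt.2 h)

lemma countLT_self (hs : StrictMono s) (ht : Tendsto s atTop atTop) (k : ℕ) :
    countLT s (s k) = k :=
  eq_of_forall_lt_iff fun _ => by rw [lt_countLT hs ht, hs.lt_iff_lt]

lemma countLE_self (hs : StrictMono s) (ht : Tendsto s atTop atTop) (k : ℕ) :
    countLE s (s k) = k + 1 :=
  eq_of_forall_lt_iff fun _ => by rw [lt_countLE hs ht, hs.le_iff_le, Nat.lt_succ_iff]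

lemma countLE_eq_countLT (hs : StrictMono s) (ht : Tendsto s atTop atTop) (hx : x ∉ range s) :
    countLE s x = countLT s x :=
  eq_of_forall_lt_iff fun k => by
    rw [lt_countLE hs ht, lt_countLT hs ht, le_iff_lt_or_eq, or_iff_left fun h => hx ⟨k, h⟩]

lemma countLE_eq_countLT_add (hs : StrictMono s) (ht : Tendsto s atTop atTop) (x : ℝ) :
    (countLE s x : ℤ) = countLT s x + (range s).indicator 1 x := by
  by_cases hx : x ∈ range s
  · rw [indicator_of_mem hx]
    obtain ⟨k, rfl⟩ := hx
    rw [countLT_self hs ht, countLE_self hs ht]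
    simp
  · rw [indicator_of_notMem hx, countLE_eq_countLT hs ht hx, add_zero]

lemma eventually_count_left (hs : StrictMono s) (ht : Tendsto s atTop atTop) (x : ℝ) :
    ∀ᶠ t in 𝓝[<] x, countLT s t = countLT s x ∧ countLE s t = countLT s x := by
  have h1 : ∀ᶠ t in 𝓝[<] x, ∀ k ∈ Finset.range (countLT s x), s k < t := by
    refine (Finset.eventually_all _).2 fun k hk => ?_
    rw [Finset.mem_range, lt_countLT hs ht] at hk
    exact nhdsWithin_le_nhds (Ioi_mem_nhds hk)
  filter_upwards [h1, self_mem_nhdsWithin] with t h1 htx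
  have htx : t < x := htx
  constructor
  · refine eq_of_forall_lt_iff fun k => ⟨fun hk => ?_, fun hk => ?_⟩
    · rw [lt_countLT hs ht] at hk ⊢
      exact hk.trans htx
    · rw [lt_countLT hs ht]
      exact h1 k (Finset.mem_range.2 hk)
  · refine eq_of_forall_lt_iff fun k => ⟨fun hk => ?_, fun hk => ?_⟩
    · rw [lt_countLE hs ht] at hk
      rw [lt_countLT hs ht]
      exact hk.trans_lt htx
    · rw [lt_countLE hs ht]
      exact (h1 k (Finset.mem_range.2 hk)).le

lemma eventually_count_right (hs : StrictMono s) (ht : Tendsto s atTop atTop) (x : ℝ) :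
    ∀ᶠ t in 𝓝[>] x, countLT s t = countLE s x ∧ countLE s t = countLE s x := by
  have h0 : x < s (countLE s x) := by
    rw [← not_le, ← lt_countLE hs ht]
    exact lt_irrefl _
  filter_upwards [Ioo_mem_nhdsGT h0] with t htx
  have h1 : ∀ k, s k ≤ t → k < countLE s x := fun k hk =>
    hs.lt_iff_lt.1 (hk.trans_lt htx.2)
  constructor
  · refine eq_of_forall_lt_iff fun k => ⟨fun hk => ?_, fun hk => ?_⟩
    · rw [lt_countLT hs ht] at hk
      exact h1 k hk.le
    · rw [lt_countLE hs ht] at hk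
      rw [lt_countLT hs ht]
      exact hk.trans_lt htx.1
  · refine eq_of_forall_lt_iff fun k => ⟨fun hk => ?_, fun hk => ?_⟩
    · rw [lt_countLE hs ht] at hk
      exact h1 k hk
    · rw [lt_countLE hs ht] at hk ⊢
      exact hk.trans htx.1.le

/-- The points at which the difference of the counting functions of two sequences changes from zero
to nonzero or from nonzero to zero. -/
def countSwitches (s₀ s₁ : ℕ → ℝ) : Set ℝ :=
  {x | ¬ (countLT s₁ x = countLT s₀ x ↔ countLE s₁ x = countLE s₀ x)}

lemma countLT_eq_of_forall (hs : StrictMono s) (ht : Tendsto s atTop atTop) {n : ℕ}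
    (h1 : ∀ k < n, s k < x) (h2 : x ≤ s n) : countLT s x = n :=
  eq_of_forall_lt_iff fun k => by
    rw [lt_countLT hs ht]
    exact ⟨fun h => hs.lt_iff_lt.1 (h.trans_le h2), h1 k⟩

lemma countLE_eq_of_forall (hs : StrictMono s) (ht : Tendsto s atTop atTop) {n : ℕ}
    (h1 : ∀ k < n, s k ≤ x) (h2 : x < s n) : countLE s x = n :=
  eq_of_forall_lt_iff fun k => by
    rw [lt_countLE hs ht]
    exact ⟨fun h => hs.lt_iff_lt.1 (h.trans_lt h2), h1 k⟩

lemma mem_range_of_mem_countSwitches (hs₀ : StrictMono s₀) (ht₀ : Tendsto s₀ atTop atTop)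
    (hs₁ : StrictMono s₁) (ht₁ : Tendsto s₁ atTop atTop) (hx : x ∈ countSwitches s₀ s₁) :
    x ∈ range s₀ ∨ x ∈ range s₁ := by
  by_contra! hcon
  refine hx ?_
  rw [countLE_eq_countLT hs₀ ht₀ hcon.1, countLE_eq_countLT hs₁ ht₁ hcon.2]

/-- Two increasing sequences `s₁`, `s₀` whose difference of counting functions is nonnegative, and
that interlace up to the index `m`, produce at least `2 m + 1` switches of the difference between
zero and nonzero. If `s₁` is an index ahead of `s₀` from `m` on, there are no other switches. -/
theorem encard_countSwitches (hs₀ : StrictMono s₀) (ht₀ : Tendsto s₀ atTop atTop)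
    (hs₁ : StrictMono s₁) (ht₁ : Tendsto s₁ atTop atTop)
    (hgap : ∀ k, s₁ k = s₀ k → s₁ (k + 1) < s₀ (k + 1))
    (hgap' : ∀ m, s₁ (m + 1) ≤ s₀ m → ∀ k, m ≤ k → s₁ (k + 1) ≤ s₀ k)
    (hnn : ∀ x, countLE s₀ x ≤ countLE s₁ x) (m : ℕ)
    (h : ∀ k < m, s₁ k < s₀ k ∧ s₀ k < s₁ (k + 1)) :
    ((2 * m + 1 : ℕ) : ℕ∞) ≤ (countSwitches s₀ s₁).encard ∧
      (s₁ (m + 1) ≤ s₀ m → (countSwitches s₀ s₁).encard = ((2 * m + 1 : ℕ) : ℕ∞)) := by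
  classical
  have hle : ∀ k, s₁ k ≤ s₀ k := by
    intro k
    have := hnn (s₀ k)
    rw [countLE_self hs₀ ht₀] at this
    exact (lt_countLE hs₁ ht₁).1 this
  -- a point of `s₁` is a switch if exactly the smaller indices of `s₀` come before it
  have hsw₁ : ∀ k, (∀ j < k, s₀ j < s₁ k) → s₁ k < s₀ k → s₁ k ∈ countSwitches s₀ s₁ := by
    intro k h1 h2 hiff
    rw [countLT_self hs₁ ht₁, countLE_self hs₁ ht₁, countLT_eq_of_forall hs₀ ht₀ h1 h2.le,
      countLE_eq_of_forall hs₀ ht₀ (fun j hj => (h1 j hj).le) h2] at hiff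
    have := hiff.1 rfl
    omega
  have hbefore : ∀ k ≤ m, ∀ j < k, s₀ j < s₁ k := fun k hk j hj =>
    (h j (hj.trans_le hk)).2.trans_le (hs₁.monotone hj)
  have hmem₁ : ∀ k < m, s₁ k ∈ countSwitches s₀ s₁ := fun k hk =>
    hsw₁ k (hbefore k hk.le) (h k hk).1
  have hmem₀ : ∀ k < m, s₀ k ∈ countSwitches s₀ s₁ := by
    intro k hk hiff
    have h1 : ∀ j < k + 1, s₁ j < s₀ k := fun j hj =>
      (hs₁.monotone (Nat.lt_succ_iff.1 hj)).trans_lt (h k hk).1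
    rw [countLT_self hs₀ ht₀, countLE_self hs₀ ht₀,
      countLT_eq_of_forall hs₁ ht₁ h1 (h k hk).2.le,
      countLE_eq_of_forall hs₁ ht₁ (fun j hj => (h1 j hj).le) (h k hk).2] at hiff
    have := hiff.2 rfl
    omega
  -- the last switch: if `s₁ m` and `s₀ m` coincide they cancel, and `s₁ (m + 1)` takes over
  obtain ⟨x, hx, hmx, hxm⟩ : ∃ x ∈ countSwitches s₀ s₁, s₁ m ≤ x ∧ (s₁ m < s₀ m → x = s₁ m) := by
    rcases (hle m).lt_or_eq with hlt | heq
    · exact ⟨s₁ m, hsw₁ m (hbefore m le_rfl) hlt, le_rfl, fun _ => rfl⟩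
    · refine ⟨s₁ (m + 1), hsw₁ (m + 1) (fun j hj => ?_) (hgap m heq),
        hs₁.monotone (Nat.le_succ m), fun hlt => absurd heq hlt.ne⟩
      calc s₀ j ≤ s₀ m := hs₀.monotone (Nat.lt_succ_iff.1 hj)
        _ = s₁ m := heq.symm
        _ < s₁ (m + 1) := hs₁ (Nat.lt_succ_self m)
  set F : Finset ℝ := ((Finset.range m).image s₁ ∪ (Finset.range m).image s₀) ∪ {x} with hF
  have hcard : F.card = 2 * m + 1 := by
    rw [hF, Finset.card_union_of_disjoint, Finset.card_union_of_disjoint,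
      Finset.card_image_of_injective _ hs₁.injective,
      Finset.card_image_of_injective _ hs₀.injective]
    · simp
      omega
    · rw [Finset.disjoint_left]
      intro z hz1 hz0
      obtain ⟨i, hi, rfl⟩ := Finset.mem_image.1 hz1
      obtain ⟨j, hj, hij⟩ := Finset.mem_image.1 hz0
      rw [Finset.mem_range] at hi hj
      rcases lt_or_ge j i with hji | hji
      · exact (hbefore i hi.le j hji).ne hij
      · exact ((h i hi).1.trans_le (hs₀.monotone hji)).ne' hij
    · rw [Finset.disjoint_singleton_right]
      intro hxF
      rcases Finset.mem_union.1 hxF with hxF | hxF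
      · obtain ⟨i, hi, rfl⟩ := Finset.mem_image.1 hxF
        exact absurd (hs₁ (Finset.mem_range.1 hi)) (not_lt.2 hmx)
      · obtain ⟨i, hi, rfl⟩ := Finset.mem_image.1 hxF
        exact absurd (hbefore m le_rfl i (Finset.mem_range.1 hi)) (not_lt.2 hmx)
  have hsub : (F : Set ℝ) ⊆ countSwitches s₀ s₁ := by
    intro z hz
    rw [Finset.mem_coe, hF, Finset.mem_union, Finset.mem_union, Finset.mem_image, Finset.mem_image,
      Finset.mem_singleton] at hz
    rcases hz with (⟨i, hi, rfl⟩ | ⟨i, hi, rfl⟩) | rfl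
    · exact hmem₁ i (Finset.mem_range.1 hi)
    · exact hmem₀ i (Finset.mem_range.1 hi)
    · exact hx
  have hFe : (F : Set ℝ).encard = ((2 * m + 1 : ℕ) : ℕ∞) := by
    rw [encard_coe_eq_coe_finsetCard, hcard]
  refine ⟨hFe ▸ encard_le_encard hsub, fun hlast => ?_⟩
  rw [← hFe]
  congr 1
  refine Subset.antisymm (fun z hz => ?_) hsub
  have hahead := hgap' m hlast
  have hxeq : x = s₁ m := hxm ((hs₁ (Nat.lt_succ_self m)).trans_le hlast)
  rw [Finset.mem_coe, hF, Finset.mem_union, Finset.mem_union, Finset.mem_image, Finset.mem_image,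
    Finset.mem_singleton]
  rcases mem_range_of_mem_countSwitches hs₀ ht₀ hs₁ ht₁ hz with ⟨k, rfl⟩ | ⟨k, rfl⟩
  · rcases lt_or_ge k m with hk | hk
    · exact Or.inl (Or.inr ⟨k, Finset.mem_range.2 hk, rfl⟩)
    · refine absurd ?_ hz
      have h1 : k < countLT s₁ (s₀ k) := (lt_countLT hs₁ ht₁).2
        ((hs₁ (Nat.lt_succ_self k)).trans_le (hahead k hk))
      have h2 : k + 1 < countLE s₁ (s₀ k) := (lt_countLE hs₁ ht₁).2 (hahead k hk)
      rw [countLT_self hs₀ ht₀, countLE_self hs₀ ht₀]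
      constructor <;> intro <;> omega
  · rcases lt_trichotomy k m with hk | rfl | hk
    · exact Or.inl (Or.inl ⟨k, Finset.mem_range.2 hk, rfl⟩)
    · exact Or.inr hxeq.symm
    · refine absurd ?_ hz
      obtain ⟨i, rfl⟩ : ∃ i, k = i + 1 := ⟨k - 1, by omega⟩
      have h1 : ¬ i < countLT s₀ (s₁ (i + 1)) := by
        rw [lt_countLT hs₀ ht₀, not_lt]
        exact hahead i (by omega)
      have h2 : ¬ i + 1 < countLE s₀ (s₁ (i + 1)) := by
        rw [lt_countLE hs₀ ht₀, not_le]
        exact (hs₁ (Nat.lt_succ_self _)).trans_le (hahead (i + 1) (by omega))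
      rw [countLT_self hs₁ ht₁, countLE_self hs₁ ht₁]
      constructor <;> intro <;> omega

end interlacing

/-! ### Stability switches -/

namespace Coeffs

variable {a : Coeffs} {τ : ℝ}

namespace HasTwoFrequencies

variable (H : a.HasTwoFrequencies)
include H

/-- The number of unstable roots, for every delay: it increases by two behind each critical delay
of index `1` and decreases by two at each one of index `0`. Both sides of the equation have the same
jumps, so that their difference is locally constant. -/
theorem unstableCount_eq (h0 : 0 < a.critDelay 0 0) (hτ : 0 ≤ τ) :
    (a.unstableCount τ : ℤ) = a.unstableCount 0 + 2 * countLT (a.critDelay 1) τ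
      - 2 * countLE (a.critDelay 0) τ := by
  set g : ℝ → ℤ := fun t => a.unstableCount t - 2 * countLT (a.critDelay 1) t
    + 2 * countLE (a.critDelay 0) t with hg
  have hm := H.critDelay_strictMono
  have ht := H.critDelay_tendsto
  have hright : ∀ x, 0 ≤ x → ContinuousWithinAt g (Ioi x) x := by
    intro x hx
    refine (tendsto_const_nhds (x := g x)).congr' ?_
    filter_upwards [H.eventually_unstableCount_right hx, eventually_count_right (hm 0) (ht 0) x,
      eventually_count_right (hm 1) (ht 1) x] with t h1 h2 h3
    have h4 := countLE_eq_countLT_add (hm 1) (ht 1) x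
    simp only [hg, h1, h2.2, h3.1, h4]
    ring
  have hleft : ∀ x, 0 < x → ContinuousWithinAt g (Iio x) x := by
    intro x hx
    refine (tendsto_const_nhds (x := g x)).congr' ?_
    filter_upwards [H.eventually_unstableCount_left hx, eventually_count_left (hm 0) (ht 0) x,
      eventually_count_left (hm 1) (ht 1) x] with t h1 h2 h3
    have h4 := countLE_eq_countLT_add (hm 0) (ht 0) x
    simp only [hg, h1, h2.2, h3.1, h4]
    ring
  have hcont : ContinuousOn g (Ici 0) := by
    intro x hx
    rcases (mem_Ici.1 hx).lt_or_eq with hpos | rfl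
    · exact (continuousAt_iff_continuous_left'_right'.2
        ⟨hleft x hpos, hright x hpos.le⟩).continuousWithinAt
    · exact continuousWithinAt_Ioi_iff_Ici.1 (hright 0 le_rfl)
  have hconst := isPreconnected_Ici.constant hcont (mem_Ici.2 hτ) (self_mem_Ici (a := (0 : ℝ)))
  have h1 : countLT (a.critDelay 1) 0 = 0 :=
    countLT_eq_of_forall (hm 1) (ht 1) (by simp) (H.critDelay_nonneg 1 0)
  have h2 : countLE (a.critDelay 0) 0 = 0 :=
    countLE_eq_of_forall (hm 0) (ht 0) (by simp) h0
  simp only [hg, h1, h2] at hconst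
  push_cast at hconst
  linarith

lemma eventually_unstableCount_right_eq (h0 : 0 < a.critDelay 0 0) {x : ℝ} (hx : 0 ≤ x) :
    ∀ᶠ t in 𝓝[>] x, (a.unstableCount t : ℤ) = a.unstableCount 0 + 2 * countLE (a.critDelay 1) x
      - 2 * countLE (a.critDelay 0) x := by
  filter_upwards [self_mem_nhdsWithin,
    eventually_count_right (H.critDelay_strictMono 0) (H.critDelay_tendsto 0) x,
    eventually_count_right (H.critDelay_strictMono 1) (H.critDelay_tendsto 1) x] with t ht h1 h2
  rw [H.unstableCount_eq h0 (hx.trans (le_of_lt ht)), h1.2, h2.1]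

lemma eventually_unstableCount_left_eq (h0 : 0 < a.critDelay 0 0) {x : ℝ} (hx : 0 < x) :
    ∀ᶠ t in 𝓝[<] x, (a.unstableCount t : ℤ) = a.unstableCount 0 + 2 * countLT (a.critDelay 1) x
      - 2 * countLT (a.critDelay 0) x := by
  filter_upwards [nhdsWithin_le_nhds (Ici_mem_nhds hx),
    eventually_count_left (H.critDelay_strictMono 0) (H.critDelay_tendsto 0) x,
    eventually_count_left (H.critDelay_strictMono 1) (H.critDelay_tendsto 1) x] with t ht h1 h2
  rw [H.unstableCount_eq h0 ht, h1.2, h2.1]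

lemma countLE_le (h0 : 0 < a.critDelay 0 0) {x : ℝ} (hx : 0 ≤ x) :
    2 * countLE (a.critDelay 0) x ≤ a.unstableCount 0 + 2 * countLE (a.critDelay 1) x := by
  obtain ⟨t, ht⟩ := (H.eventually_unstableCount_right_eq h0 hx).exists
  omega

lemma countLT_le (h0 : 0 < a.critDelay 0 0) {x : ℝ} (hx : 0 < x) :
    2 * countLT (a.critDelay 0) x ≤ a.unstableCount 0 + 2 * countLT (a.critDelay 1) x := by
  obtain ⟨t, ht⟩ := (H.eventually_unstableCount_left_eq h0 hx).exists
  omega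

lemma eventually_not_critical {l : Filter ℝ} (i : Fin 2)
    (hl : ∀ᶠ t in l, countLT (a.critDelay i) t = countLE (a.critDelay i) t) :
    ∀ᶠ t in l, t ∉ range (a.critDelay i) := by
  filter_upwards [hl] with t ht hmem
  have := countLE_eq_countLT_add (H.critDelay_strictMono i) (H.critDelay_tendsto i) t
  rw [indicator_of_mem hmem, ht] at this
  simp at this

lemma eventually_not_critical_left (x : ℝ) : ∀ᶠ t in 𝓝[<] x, ∀ i, t ∉ range (a.critDelay i) :=
  eventually_all.2 fun i => H.eventually_not_critical i <|
    (eventually_count_left (H.critDelay_strictMono i) (H.critDelay_tendsto i) x).mono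
      fun _ h => h.1.trans h.2.symm

lemma eventually_not_critical_right (x : ℝ) : ∀ᶠ t in 𝓝[>] x, ∀ i, t ∉ range (a.critDelay i) :=
  eventually_all.2 fun i => H.eventually_not_critical i <|
    (eventually_count_right (H.critDelay_strictMono i) (H.critDelay_tendsto i) x).mono
      fun _ h => h.1.trans h.2.symm

lemma isStable_of_unstableCount_eq_zero (hτ : 0 ≤ τ) (hcrit : ∀ i, τ ∉ range (a.critDelay i))
    (h : a.unstableCount τ = 0) : a.IsStable τ := by
  refine isStable_of_charFun_ne_zero H.abs_lt hτ fun z hz h0 => ?_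
  rcases hz.lt_or_eq with hpos | hzero
  · exact h.not_gt ((unstableCount_pos_iff H.abs_lt hτ).2 ⟨z, hpos, h0⟩)
  · obtain ⟨i, k, hk, -⟩ := (H.charFun_eq_zero_iff_of_re_eq_zero hzero.symm hτ).1 h0
    exact hcrit i ⟨k, hk.symm⟩

omit H in
lemma isUnstable_of_unstableCount_pos (hb : |a.a11 * a.a22| < |a.a12 * a.a21|) (hτ : 0 ≤ τ)
    (h : 0 < a.unstableCount τ) : a.IsUnstable τ := by
  obtain ⟨z, hz, h0⟩ := (unstableCount_pos_iff hb hτ).1 h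
  exact isUnstable_of_charFun_eq_zero hb h0 hz

/-- A switch at a delay is a change of the number of unstable roots between zero and nonzero, when
the roots that cross the imaginary axis at that delay are included or not. -/
theorem isSwitch_iff (h0 : 0 < a.critDelay 0 0) {x : ℝ} (hx : 0 < x) :
    a.IsSwitch x ↔
      ¬ (a.unstableCount 0 + 2 * countLT (a.critDelay 1) x = 2 * countLT (a.critDelay 0) x ↔
        a.unstableCount 0 + 2 * countLE (a.critDelay 1) x = 2 * countLE (a.critDelay 0) x) := by
  have hL0 : a.unstableCount 0 + 2 * countLT (a.critDelay 1) x = 2 * countLT (a.critDelay 0) x →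
      ∀ᶠ t in 𝓝[<] x, a.IsStable t := by
    intro h
    filter_upwards [H.eventually_unstableCount_left_eq h0 hx, H.eventually_not_critical_left x,
      nhdsWithin_le_nhds (Ici_mem_nhds hx)] with t h1 h2 h3
    exact H.isStable_of_unstableCount_eq_zero h3 h2 (by omega)
  have hL1 : a.unstableCount 0 + 2 * countLT (a.critDelay 1) x ≠ 2 * countLT (a.critDelay 0) x →
      ∀ᶠ t in 𝓝[<] x, a.IsUnstable t := by
    intro h
    have := H.countLT_le h0 hx
    filter_upwards [H.eventually_unstableCount_left_eq h0 hx,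
      nhdsWithin_le_nhds (Ici_mem_nhds hx)] with t h1 h3
    exact isUnstable_of_unstableCount_pos H.abs_lt h3 (by omega)
  have hR0 : a.unstableCount 0 + 2 * countLE (a.critDelay 1) x = 2 * countLE (a.critDelay 0) x →
      ∀ᶠ t in 𝓝[>] x, a.IsStable t := by
    intro h
    filter_upwards [H.eventually_unstableCount_right_eq h0 hx.le,
      H.eventually_not_critical_right x, self_mem_nhdsWithin] with t h1 h2 h3
    exact H.isStable_of_unstableCount_eq_zero (hx.le.trans (le_of_lt h3)) h2 (by omega)
  have hR1 : a.unstableCount 0 + 2 * countLE (a.critDelay 1) x ≠ 2 * countLE (a.critDelay 0) x →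
      ∀ᶠ t in 𝓝[>] x, a.IsUnstable t := by
    intro h
    have := H.countLE_le h0 hx.le
    filter_upwards [H.eventually_unstableCount_right_eq h0 hx.le, self_mem_nhdsWithin] with t h1 h3
    exact isUnstable_of_unstableCount_pos H.abs_lt (hx.le.trans (le_of_lt h3)) (by omega)
  have hexcl : ∀ {l : Filter ℝ} [l.NeBot], (∀ᶠ t in l, a.IsStable t) →
      (∀ᶠ t in l, a.IsUnstable t) → False := by
    intro l _ h1 h2
    obtain ⟨t, h3, h4⟩ := (h1.and h2).exists
    exact h3.not_isUnstable h4
  constructor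
  · rintro ⟨-, ⟨h1, h2⟩ | ⟨h1, h2⟩⟩ hiff
    · have h3 : a.unstableCount 0 + 2 * countLT (a.critDelay 1) x
          = 2 * countLT (a.critDelay 0) x := by
        by_contra h
        exact hexcl h1 (hL1 h)
      exact hexcl (hR0 (hiff.1 h3)) h2
    · have h3 : a.unstableCount 0 + 2 * countLE (a.critDelay 1) x
          = 2 * countLE (a.critDelay 0) x := by
        by_contra h
        exact hexcl h2 (hR1 h)
      exact hexcl (hL0 (hiff.2 h3)) h1
  · intro h
    refine ⟨hx, ?_⟩
    by_cases h1 : a.unstableCount 0 + 2 * countLT (a.critDelay 1) x = 2 * countLT (a.critDelay 0) x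
    · exact Or.inl ⟨hL0 h1, hR1 fun h2 => h ⟨fun _ => h2, fun _ => h1⟩⟩
    · by_cases h2 : a.unstableCount 0 + 2 * countLE (a.critDelay 1) x
        = 2 * countLE (a.critDelay 0) x
      · exact Or.inr ⟨hL1 h1, hR0 h2⟩
      · exact absurd ⟨fun h => absurd h h1, fun h => absurd h h2⟩ h

lemma critDelay_zero_pos (h : ∀ z : ℂ, z.re = 0 → a.charFun 0 z ≠ 0) (i : Fin 2) :
    0 < a.critDelay i 0 := by
  refine (H.critDelay_nonneg i 0).lt_of_ne fun h0 => h (a.omega i * Complex.I) (by simp) ?_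
  exact (H.charFun_eq_zero_iff_of_re_eq_zero (by simp) le_rfl).2 ⟨i, 0, h0, Or.inl rfl⟩

omit H in
lemma critDelay_succ (a : Coeffs) (i : Fin 2) (k : ℕ) :
    a.critDelay i (k + 1) = a.critDelay i k + 2 * Real.pi / a.omega i := by
  rw [critDelay, critDelay]
  push_cast
  ring

lemma period_lt : 2 * Real.pi / a.omega 1 < 2 * Real.pi / a.omega 0 :=
  div_lt_div_of_pos_left Real.two_pi_pos (H.omega_pos 0) H.omega_lt

/-- The case of a system that is stable without delay. -/
theorem numSwitches_of_isStable_zero (hs : a.IsStable 0) (m : ℕ)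
    (h : ∀ k < m, a.critDelay 1 k < a.critDelay 0 k ∧ a.critDelay 0 k < a.critDelay 1 (k + 1)) :
    ((2 * m + 1 : ℕ) : ℕ∞) ≤ a.numSwitches ∧
      (a.critDelay 1 (m + 1) ≤ a.critDelay 0 m → a.numSwitches = ((2 * m + 1 : ℕ) : ℕ∞)) := by
  have hm := H.critDelay_strictMono
  have ht := H.critDelay_tendsto
  have hroot : ∀ z : ℂ, 0 ≤ z.re → a.charFun 0 z ≠ 0 := fun z hz => hs.charFun_ne_zero H.abs_lt hz
  have hpos := H.critDelay_zero_pos fun z hz => hroot z hz.ge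
  have hN : a.unstableCount 0 = 0 := by
    by_contra hne
    obtain ⟨z, hz, hz0⟩ := (unstableCount_pos_iff H.abs_lt le_rfl).1 (Nat.pos_of_ne_zero hne)
    exact hroot z hz.le hz0
  have hposk : ∀ i k, 0 < a.critDelay i k := fun i k =>
    (hpos i).trans_le ((hm i).monotone (Nat.zero_le k))
  have hset : {x | a.IsSwitch x} = countSwitches (a.critDelay 0) (a.critDelay 1) := by
    ext x
    rcases lt_or_ge 0 x with hx | hx
    · rw [mem_ofPred_eq, H.isSwitch_iff (hpos 0) hx, hN]
      simp [countSwitches]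
    · refine ⟨fun h => absurd h.1 (not_lt.2 hx), fun h => ?_⟩
      rcases mem_range_of_mem_countSwitches (hm 0) (ht 0) (hm 1) (ht 1) h with ⟨k, rfl⟩ | ⟨k, rfl⟩
      · exact absurd (hposk 0 k) (not_lt.2 hx)
      · exact absurd (hposk 1 k) (not_lt.2 hx)
  rw [numSwitches, hset]
  refine encard_countSwitches (hm 0) (ht 0) (hm 1) (ht 1) (fun k hk => ?_) (fun m hm' => ?_)
    (fun x => ?_) m h
  · rw [critDelay_succ, critDelay_succ, hk]
    linarith [H.period_lt]
  · intro k hk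
    induction k, hk using Nat.le_induction with
    | base => exact hm'
    | succ k _ ih =>
      rw [critDelay_succ a 1 (k + 1), critDelay_succ a 0 k]
      linarith [H.period_lt]
  · rcases le_or_gt 0 x with hx | hx
    · have := H.countLE_le (hpos 0) hx
      omega
    · rw [countLE_eq_of_forall (hm 0) (ht 0) (n := 0) (by simp) (hx.trans (hpos 0))]
      exact Nat.zero_le _

end HasTwoFrequencies

/-- If the undelayed system has imaginary eigenvalues then its solutions are bounded: the energy
`r'² + x² r²`, where `x` is the frequency, is conserved. -/
lemma IsUnstable.charFun_zero_ne_zero_of_re_eq_zero (hb : |a.a11 * a.a22| < |a.a12 * a.a21|)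
    (hu : a.IsUnstable 0) {z : ℂ} (hz : z.re = 0) : a.charFun 0 z ≠ 0 := by
  intro hz0
  have hzI : z = z.im * Complex.I := by
    apply Complex.ext <;> simp [hz]
  set x := z.im
  have hx : x ≠ 0 := by
    intro hx
    rw [hx] at hzI
    exact charFun_zero_ne_zero hb (τ := 0) (by rw [hzI] at hz0; simpa using hz0)
  rw [hzI, charFun_mul_I_eq_zero_iff] at hz0
  simp only [mul_zero, Real.sin_zero, Real.cos_zero, mul_one, add_zero, zero_sub] at hz0
  obtain ⟨h1, h2⟩ := hz0
  have h3 : a.a11 = -a.a22 := by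
    have : (a.a11 + a.a22) * x = 0 := by linarith
    linarith [(mul_eq_zero.1 this).resolve_right hx]
  have ha12 : a.a12 ≠ 0 := fun h => a12_mul_a21_ne_zero hb (by rw [h, zero_mul])
  obtain ⟨r, j, hs, hM⟩ := hu
  set Q : ℝ → ℝ := fun t => (a.a11 * r t + a.a12 * j t) ^ 2 + x ^ 2 * r t ^ 2 with hQ
  have hder : ∀ t, 0 ≤ t → HasDerivWithinAt Q 0 (Ici 0) t := by
    intro t ht
    have hr := hs.deriv_r t ht
    have hj := hs.deriv_j t ht
    rw [sub_zero] at hr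
    have h4 := (((hr.const_mul a.a11).add (hj.const_mul a.a12)).pow 2).add
      ((hr.pow 2).const_mul (x ^ 2))
    refine (h4.congr_deriv ?_)
    simp only [Pi.add_apply]
    push_cast
    have h5 : x ^ 2 = -a.a22 ^ 2 - a.a12 * a.a21 := by
      rw [h3] at h1
      linarith
    rw [h5, h3]
    ring
  have hconst : ∀ t, 0 ≤ t → Q t = Q 0 := by
    intro t ht
    refine constant_of_has_deriv_right_zero (fun s hs => ?_) (fun s hs => ?_) t ⟨ht, le_rfl⟩
    · exact (hder s hs.1).continuousWithinAt.mono Icc_subset_Ici_self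
    · exact (hder s hs.1).mono (Ici_subset_Ici.2 hs.1)
  have hQ0 : 0 ≤ Q 0 := by positivity
  have hr : ∀ t, 0 ≤ t → |r t| ≤ √(Q 0) / |x| := by
    intro t ht
    rw [le_div_iff₀ (abs_pos.2 hx), ← abs_mul]
    refine Real.abs_le_sqrt ?_
    rw [← hconst t ht, hQ]
    nlinarith [sq_nonneg (a.a11 * r t + a.a12 * j t)]
  have hj : ∀ t, 0 ≤ t → |j t| ≤ (√(Q 0) + |a.a11| * (√(Q 0) / |x|)) / |a.a12| := by
    intro t ht
    rw [le_div_iff₀ (abs_pos.2 ha12), ← abs_mul]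
    have h4 : |a.a11 * r t + a.a12 * j t| ≤ √(Q 0) := by
      refine Real.abs_le_sqrt ?_
      rw [← hconst t ht, hQ]
      nlinarith [mul_nonneg (sq_nonneg x) (sq_nonneg (r t))]
    have h5 : |a.a11 * r t| ≤ |a.a11| * (√(Q 0) / |x|) := by
      rw [abs_mul]
      exact mul_le_mul_of_nonneg_left (hr t ht) (abs_nonneg _)
    have h6 := abs_sub (a.a11 * r t + a.a12 * j t) (a.a11 * r t)
    rw [add_sub_cancel_left] at h6
    rw [mul_comm]
    linarith
  obtain ⟨t, ht, hMt⟩ := hM (√(Q 0) / |x| + (√(Q 0) + |a.a11| * (√(Q 0) / |x|)) / |a.a12|)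
  linarith [hr t ht, hj t ht]

lemma zeroCount_id_sub_const_le (w : ℂ) (U : Set ℂ) : zeroCount (fun z => z - w) U ≤ 1 := by
  by_cases hw : w ∈ U
  · exact (zeroCount_id_sub_const hw).le
  · rw [zeroCount_eq_zero]
    · exact Nat.zero_le _
    · intro z hz h
      exact hw (sub_eq_zero.1 h ▸ hz)

/-- Without delay the characteristic function is a polynomial of degree two. -/
lemma unstableCount_zero_le (a : Coeffs) : a.unstableCount 0 ≤ 2 := by
  obtain ⟨δ, hδ⟩ := IsAlgClosed.exists_eq_mul_self
    (((a.a11 : ℂ) + a.a22) ^ 2 - 4 * (a.a11 * a.a22 - a.a12 * a.a21))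
  set α : ℂ := (a.a11 + a.a22 + δ) / 2 with hα
  set β : ℂ := (a.a11 + a.a22 - δ) / 2 with hβ
  have hfac : a.charFun 0 = (fun z => z - α) * fun z => z - β := by
    funext z
    simp only [charFun, Complex.ofReal_zero, mul_zero, neg_zero, Complex.exp_zero, mul_one,
      Pi.mul_apply, hα, hβ]
    linear_combination (-1 / 4 : ℂ) * hδ
  obtain ⟨w, hw⟩ := Set.Finite.exists_notMem (s := ({α, β} : Set ℂ)) (by simp)
  simp only [mem_insert_iff, mem_singleton_iff, not_or] at hw
  have h1 : a.unstableCount 0 = zeroCount (a.charFun 0) ({z | 0 < z.re} ∩ {α, β}) := by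
    refine zeroCount_congr_set fun z hz => ?_
    rw [hfac, Pi.mul_apply, mul_eq_zero, sub_eq_zero, sub_eq_zero] at hz
    simp [hz]
  rw [h1, hfac, zeroCount_mul (f := fun z => z - α) (g := fun z => z - β) (w := w) (by fun_prop) (by fun_prop) (sub_ne_zero.2 hw.1)
    (sub_ne_zero.2 hw.2) ((toFinite _).isBounded.subset inter_subset_right)]
  exact add_le_add (zeroCount_id_sub_const_le _ _) (zeroCount_id_sub_const_le _ _)

namespace HasTwoFrequencies

variable (H : a.HasTwoFrequencies)
include H

lemma unstableCount_zero_pos (hu : a.IsUnstable 0) : 0 < a.unstableCount 0 := by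
  by_contra hne
  refine (isStable_of_charFun_ne_zero H.abs_lt le_rfl fun z hz h0 => ?_).not_isUnstable hu
  rcases hz.lt_or_eq with hpos | hzero
  · exact hne ((unstableCount_pos_iff H.abs_lt le_rfl).2 ⟨z, hpos, h0⟩)
  · exact hu.charFun_zero_ne_zero_of_re_eq_zero H.abs_lt hzero.symm h0

/-- The case of a system that is unstable without delay. Two unstable roots at the delay zero are
accounted for by a fictitious critical delay `-1` of index `1`, which reduces the count to that for
systems that are stable without delay. With one unstable root there is always one. -/
theorem numSwitches_of_isUnstable_zero (hu : a.IsUnstable 0) (m : ℕ)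
    (h : ∀ k < m, a.critDelay 0 k < a.critDelay 1 k)
    (h' : ∀ k, k + 1 < m → a.critDelay 1 k < a.critDelay 0 (k + 1)) :
    ((2 * m : ℕ) : ℕ∞) ≤ a.numSwitches ∧
      (a.critDelay 1 m ≤ a.critDelay 0 m → a.numSwitches = ((2 * m : ℕ) : ℕ∞)) := by
  have hm := H.critDelay_strictMono
  have ht := H.critDelay_tendsto
  have hpos := H.critDelay_zero_pos fun z hz =>
    hu.charFun_zero_ne_zero_of_re_eq_zero H.abs_lt hz
  have hposk : ∀ i k, 0 < a.critDelay i k := fun i k =>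
    (hpos i).trans_le ((hm i).monotone (Nat.zero_le k))
  have hN1 := H.unstableCount_zero_pos hu
  have hN2 := a.unstableCount_zero_le
  obtain hN | hN : a.unstableCount 0 = 1 ∨ a.unstableCount 0 = 2 := by omega
  · have hm0 : m = 0 := by
      by_contra hne
      have h1 := H.countLE_le (hpos 0) (hpos 0).le
      rw [countLE_self (hm 0) (ht 0), hN] at h1
      have h2 : 0 < countLE (a.critDelay 1) (a.critDelay 0 0) := by omega
      rw [lt_countLE (hm 1) (ht 1)] at h2
      exact absurd (h 0 (by omega)) (not_lt.2 h2)
    subst hm0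
    have hset : {x | a.IsSwitch x} = ∅ := by
      refine eq_empty_of_forall_notMem fun x hx => ?_
      rw [mem_ofPred_eq, H.isSwitch_iff (hpos 0) hx.1, hN] at hx
      refine hx ⟨fun h => ?_, fun h => ?_⟩ <;> omega
    simp [numSwitches, hset]
  · set s : ℕ → ℝ := fun n => Nat.casesOn n (-1) (a.critDelay 1) with hsdef
    have hs0 : s 0 = -1 := rfl
    have hsk : ∀ k, s (k + 1) = a.critDelay 1 k := fun _ => rfl
    have hsm : StrictMono s := by
      refine strictMono_nat_of_lt_succ fun k => ?_
      cases k with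
      | zero =>
        rw [hs0, hsk]
        linarith [hposk 1 0]
      | succ k =>
        rw [hsk, hsk]
        exact hm 1 (Nat.lt_succ_self k)
    have hst : Tendsto s atTop atTop := (tendsto_add_atTop_iff_nat 1).1 (ht 1)
    have hLT : ∀ x, -1 < x → countLT s x = countLT (a.critDelay 1) x + 1 := by
      intro x hx
      refine eq_of_forall_lt_iff fun k => ?_
      rw [lt_countLT hsm hst]
      cases k with
      | zero => simp [hs0, hx]
      | succ k => rw [hsk, Nat.add_lt_add_iff_right, lt_countLT (hm 1) (ht 1)]
    have hLE : ∀ x, -1 ≤ x → countLE s x = countLE (a.critDelay 1) x + 1 := by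
      intro x hx
      refine eq_of_forall_lt_iff fun k => ?_
      rw [lt_countLE hsm hst]
      cases k with
      | zero => simp [hs0, hx]
      | succ k => rw [hsk, Nat.add_lt_add_iff_right, lt_countLE (hm 1) (ht 1)]
    have hneg : ∀ x, x < 0 → countLE (a.critDelay 0) x = 0 := fun x hx =>
      countLE_eq_of_forall (hm 0) (ht 0) (by simp) (hx.trans (hpos 0))
    have hset : countSwitches (a.critDelay 0) s = insert (-1) {x | a.IsSwitch x} := by
      ext x
      rw [mem_insert_iff, mem_ofPred_eq]
      rcases lt_or_ge 0 x with hx | hx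
      · rw [H.isSwitch_iff (hpos 0) hx, hN, or_iff_right (by linarith), countSwitches,
          mem_ofPred_eq, hLT x (by linarith), hLE x (by linarith)]
        refine not_congr (iff_congr ?_ ?_) <;> omega
      · constructor
        · intro hmem
          left
          rcases mem_range_of_mem_countSwitches (hm 0) (ht 0) hsm hst hmem with ⟨k, rfl⟩ | ⟨k, rfl⟩
          · exact absurd (hposk 0 k) (not_lt.2 hx)
          · cases k with
            | zero => rfl
            | succ k => exact absurd (hposk 1 k) (not_lt.2 hx)
        · rintro (rfl | hsw)
          · intro hiff
            rw [hneg _ (by norm_num), hLE _ le_rfl, ← hs0, countLT_self hsm hst, hs0,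
              countLT_eq_of_forall (hm 0) (ht 0) (n := 0) (by simp) (by linarith [hpos 0])] at hiff
            have := hiff.1 rfl
            omega
          · exact absurd hsw.1 (not_lt.2 hx)
    have hcard : (countSwitches (a.critDelay 0) s).encard = a.numSwitches + 1 := by
      rw [hset, encard_insert_of_notMem, numSwitches]
      intro hsw
      have := hsw.1
      norm_num at this
    have hkey := encard_countSwitches (hm 0) (ht 0) hsm hst (fun k hk => ?_) (fun n hn => ?_)
      (fun x => ?_) m (fun k hk => ⟨?_, h k hk⟩)
    · rw [hcard, hsk] at hkey
      have h1 : (1 : ℕ∞) ≠ ⊤ := by simp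
      push_cast at hkey ⊢
      exact ⟨(ENat.add_le_add_iff_right h1).1 hkey.1,
        fun hlast => (WithTop.add_right_inj h1).1 (hkey.2 hlast)⟩
    · cases k with
      | zero =>
        rw [hs0] at hk
        linarith [hpos 0]
      | succ k =>
        rw [hsk] at hk ⊢
        rw [critDelay_succ a 1 k, critDelay_succ a 0 (k + 1), hk]
        linarith [H.period_lt]
    · intro k hk
      rw [hsk] at hn ⊢
      induction k, hk using Nat.le_induction with
      | base => exact hn
      | succ k _ ih =>
        rw [critDelay_succ a 1 k, critDelay_succ a 0 k]
        linarith [H.period_lt]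
    · rcases le_or_gt 0 x with hx | hx
      · have := H.countLE_le (hpos 0) hx
        rw [hLE x (by linarith)]
        omega
      · rw [hneg x hx]
        exact Nat.zero_le _
    · cases k with
      | zero =>
        rw [hs0]
        linarith [hpos 0]
      | succ k =>
        rw [hsk]
        exact h' k hk

end HasTwoFrequencies

end Coeffs

/-! ### Realizing every number of switches -/

namespace Coeffs

lemma HasTwoFrequencies.isStable_zero {a : Coeffs} (H : a.HasTwoFrequencies)
    (htr : a.a11 + a.a22 < 0) (hdet : 0 < a.a11 * a.a22 - a.a12 * a.a21) : a.IsStable 0 := by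
  refine isStable_of_charFun_ne_zero H.abs_lt le_rfl fun z hz h0 => ?_
  rw [charFun, Complex.ext_iff] at h0
  simp only [Complex.ofReal_zero, mul_zero, neg_zero, Complex.exp_zero, mul_one, Complex.sub_re,
    Complex.mul_re, Complex.ofReal_re, Complex.sub_im, Complex.ofReal_im, sub_zero,
    Complex.zero_re, Complex.mul_im, zero_mul, add_zero, Complex.zero_im] at h0
  obtain ⟨h1, h2⟩ := h0
  have h3 : z.im * (2 * z.re - (a.a11 + a.a22)) = 0 := by linarith
  have h4 : z.im = 0 := (mul_eq_zero.1 h3).resolve_right (by linarith)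
  rw [h4] at h1
  nlinarith [mul_nonneg hz hz, mul_nonneg hz (neg_nonneg.2 htr.le)]

lemma HasTwoFrequencies.isUnstable_zero {a : Coeffs} (H : a.HasTwoFrequencies)
    (htr : 0 < a.a11 + a.a22) : a.IsUnstable 0 := by
  obtain ⟨δ, hδ⟩ := IsAlgClosed.exists_eq_mul_self
    (((a.a11 : ℂ) + a.a22) ^ 2 - 4 * (a.a11 * a.a22 - a.a12 * a.a21))
  -- of the two roots of the quadratic equation, one with real part at least half the trace
  obtain ⟨δ, hδ, hre⟩ : ∃ δ : ℂ, ((a.a11 : ℂ) + a.a22) ^ 2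
      - 4 * (a.a11 * a.a22 - a.a12 * a.a21) = δ * δ ∧ 0 ≤ δ.re := by
    rcases le_total 0 δ.re with h | h
    · exact ⟨δ, hδ, h⟩
    · exact ⟨-δ, by rw [hδ]; ring, by simpa using h⟩
  refine isUnstable_of_charFun_eq_zero H.abs_lt (z := (a.a11 + a.a22 + δ) / 2) ?_ ?_
  · simp only [charFun, Complex.ofReal_zero, mul_zero, neg_zero, Complex.exp_zero, mul_one]
    linear_combination (-1 / 4 : ℂ) * hδ
  · have : ((a.a11 + a.a22 + δ) / 2 : ℂ).re = (a.a11 + a.a22 + δ.re) / 2 := by simp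
    rw [this]
    linarith

/-- The system with coefficients given as a point of `ℝ⁴`. -/
def ofProd (q : ℝ × ℝ × ℝ × ℝ) : Coeffs := ⟨q.1, q.2.1, q.2.2.1, q.2.2.2⟩

lemma exists_box {q₀ : ℝ × ℝ × ℝ × ℝ} {P : Coeffs → Prop} (h : ∀ᶠ q in 𝓝 q₀, P (ofProd q)) :
    ∃ l u : Coeffs, l.a11 < u.a11 ∧ l.a12 < u.a12 ∧ l.a21 < u.a21 ∧ l.a22 < u.a22 ∧
      ∀ a : Coeffs, a.a11 ∈ Ioo l.a11 u.a11 → a.a12 ∈ Ioo l.a12 u.a12 →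
        a.a21 ∈ Ioo l.a21 u.a21 → a.a22 ∈ Ioo l.a22 u.a22 → P a := by
  obtain ⟨ε, hε, hP⟩ := Metric.eventually_nhds_iff_ball.1 h
  refine ⟨⟨q₀.1 - ε, q₀.2.1 - ε, q₀.2.2.1 - ε, q₀.2.2.2 - ε⟩,
    ⟨q₀.1 + ε, q₀.2.1 + ε, q₀.2.2.1 + ε, q₀.2.2.2 + ε⟩, by simp; linarith, by simp; linarith,
    by simp; linarith, by simp; linarith, fun a h1 h2 h3 h4 => ?_⟩
  refine hP (a.a11, a.a12, a.a21, a.a22) ?_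
  rw [← Real.ball_eq_Ioo] at h1 h2 h3 h4
  simp only [Metric.mem_ball, Prod.dist_eq, max_lt_iff]
  exact ⟨h1, h2, h3, h4⟩

lemma continuous_omega (i : Fin 2) : Continuous fun q => (ofProd q).omega i := by
  unfold omega y Delta ofProd
  fun_prop

variable {q₀ : ℝ × ℝ × ℝ × ℝ}

lemma continuousAt_critDelay (H : (ofProd q₀).HasTwoFrequencies) (i : Fin 2)
    (hs : (ofProd q₀).sinVal i ≠ 0) (k : ℕ) :
    ContinuousAt (fun q => (ofProd q).critDelay i k) q₀ := by
  have ho := (continuous_omega i).continuousAt (x := q₀)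
  have h11 : ContinuousAt (fun q => (ofProd q).a11) q₀ := by unfold ofProd; fun_prop
  have h12 : ContinuousAt (fun q => (ofProd q).a12) q₀ := by unfold ofProd; fun_prop
  have h21 : ContinuousAt (fun q => (ofProd q).a21) q₀ := by unfold ofProd; fun_prop
  have h22 : ContinuousAt (fun q => (ofProd q).a22) q₀ := by unfold ofProd; fun_prop
  have hden : (ofProd q₀).a11 * ((ofProd q₀).omega i ^ 2 + (ofProd q₀).a22 ^ 2) ≠ 0 :=
    mul_ne_zero H.a11_ne_zero (H.denom_pos i).ne'
  have hcos : ContinuousAt (fun q => (ofProd q).cosVal i) q₀ :=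
    ((h12.mul h21).mul h22).div (h11.mul ((ho.pow 2).add (h22.pow 2))) hden
  have hsin : ContinuousAt (fun q => (ofProd q).sinVal i) q₀ :=
    (ho.mul (((ho.pow 2).add (h22.pow 2)).add (h12.mul h21))).neg.div
      (h11.mul ((ho.pow 2).add (h22.pow 2))) hden
  have harc : ContinuousAt (fun q => Real.arccos ((ofProd q).cosVal i)) q₀ :=
    Real.continuous_arccos.continuousAt.comp hcos
  have hphase : ContinuousAt (fun q => (ofProd q).phase i) q₀ := by
    rcases lt_or_gt_of_ne hs with hneg | hpos
    · refine ((continuousAt_const (y := 2 * Real.pi)).sub harc).congr ?_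
      filter_upwards [hsin.eventually_lt_const hneg] with q hq
      rw [phase, if_neg (not_le.2 hq)]
      rfl
    · refine harc.congr ?_
      filter_upwards [hsin.eventually_const_lt hpos] with q hq
      rw [phase, if_pos hq.le]
  exact (hphase.div ho (H.omega_pos i).ne').add (continuousAt_const.div ho (H.omega_pos i).ne')

lemma eventually_hasTwoFrequencies (H : (ofProd q₀).HasTwoFrequencies) :
    ∀ᶠ q in 𝓝 q₀, (ofProd q).HasTwoFrequencies := by
  have h1 : ContinuousAt (fun q => |(ofProd q).a11 * (ofProd q).a22|) q₀ := by
    unfold ofProd; fun_prop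
  have h2 : ContinuousAt (fun q => |(ofProd q).a12 * (ofProd q).a21|) q₀ := by
    unfold ofProd; fun_prop
  have h3 : ContinuousAt (fun q => (ofProd q).Delta) q₀ := by unfold Delta ofProd; fun_prop
  have h4 : ContinuousAt (fun q => (ofProd q).a11 ^ 2 - (ofProd q).a22 ^ 2
      - 2 * ((ofProd q).a12 * (ofProd q).a21)) q₀ := by unfold ofProd; fun_prop
  filter_upwards [h1.eventually_lt h2 H.abs_lt, h3.eventually_const_lt H.delta_pos,
    h4.eventually_const_lt H.sum_pos] with q g1 g2 g3
  exact ⟨g1, g2, g3⟩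

/-- A family of systems with vanishing `a22`, in which the frequencies are `1` and `ρ` and the
phases are `π / 2` and `3 π / 2`; the sign `ε = ±1` determines which index has which phase. -/
def model (ε ρ : ℝ) : ℝ × ℝ × ℝ × ℝ := (-ε * (ρ - 1), 1, -ρ, 0)

section model

variable {ε ρ : ℝ}

lemma sqrt_Delta_model (hε : ε ^ 2 = 1) (hρ : 1 < ρ) :
    √(ofProd (model ε ρ)).Delta = ρ ^ 2 - 1 := by
  have h : (ofProd (model ε ρ)).Delta = (ρ ^ 2 - 1) ^ 2 := by
    simp only [Delta, ofProd, model]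
    linear_combination ((ρ - 1) ^ 4 * (ε ^ 2 + 1) + 4 * ρ * (ρ - 1) ^ 2) * hε
  rw [h, Real.sqrt_sq (by nlinarith)]

lemma hasTwoFrequencies_model (hε : ε ^ 2 = 1) (hρ : 1 < ρ) :
    (ofProd (model ε ρ)).HasTwoFrequencies where
  abs_lt := by
    simp only [ofProd, model, mul_zero, abs_zero, one_mul, abs_neg]
    positivity
  delta_pos := by
    rw [← Real.sqrt_pos, sqrt_Delta_model hε hρ]
    nlinarith
  sum_pos := by
    simp only [ofProd, model]
    nlinarith [sq_nonneg (ε * (ρ - 1))]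

lemma omega_model_zero (hε : ε ^ 2 = 1) (hρ : 1 < ρ) : (ofProd (model ε ρ)).omega 0 = 1 := by
  rw [omega, y_zero, sqrt_Delta_model hε hρ, Real.sqrt_eq_one]
  simp only [ofProd, model]
  linear_combination (ρ - 1) ^ 2 / 2 * hε

lemma omega_model_one (hε : ε ^ 2 = 1) (hρ : 1 < ρ) : (ofProd (model ε ρ)).omega 1 = ρ := by
  rw [omega, y_one, sqrt_Delta_model hε hρ, Real.sqrt_eq_iff_eq_sq _ (by linarith)]
  · simp only [ofProd, model]
    linear_combination (ρ - 1) ^ 2 / 2 * hε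
  · simp only [ofProd, model]
    nlinarith [sq_nonneg (ε * (ρ - 1))]

lemma cosVal_model (i : Fin 2) : (ofProd (model ε ρ)).cosVal i = 0 := by
  simp [cosVal, ofProd, model]

lemma sinVal_model_zero (hε : ε ^ 2 = 1) (hρ : 1 < ρ) : (ofProd (model ε ρ)).sinVal 0 = -ε := by
  have hε0 : ε ≠ 0 := by rintro rfl; norm_num at hε
  have hρ0 : ρ - 1 ≠ 0 := by linarith
  rw [sinVal, omega_model_zero hε hρ, div_eq_iff (by simp [ofProd, model, hε0, hρ0])]
  simp only [ofProd, model]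
  linear_combination (1 - ρ) * hε

lemma sinVal_model_one (hε : ε ^ 2 = 1) (hρ : 1 < ρ) : (ofProd (model ε ρ)).sinVal 1 = ε := by
  have hε0 : ε ≠ 0 := by rintro rfl; norm_num at hε
  have hρ0 : ρ - 1 ≠ 0 := by linarith
  have hρ1 : ρ ≠ 0 := by linarith
  rw [sinVal, omega_model_one hε hρ, div_eq_iff (by simp [ofProd, model, hε0, hρ0, hρ1])]
  simp only [ofProd, model]
  linear_combination ρ ^ 2 * (ρ - 1) * hε

lemma phase_model_of_pos {i : Fin 2} (h : (ofProd (model ε ρ)).sinVal i = 1) :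
    (ofProd (model ε ρ)).phase i = Real.pi / 2 := by
  rw [phase, cosVal_model, h, if_pos zero_le_one, Real.arccos_zero]

lemma phase_model_of_neg {i : Fin 2} (h : (ofProd (model ε ρ)).sinVal i = -1) :
    (ofProd (model ε ρ)).phase i = 3 * Real.pi / 2 := by
  rw [phase, cosVal_model, h, if_neg (by norm_num), Real.arccos_zero]
  ring

end model

lemma eventually_critDelay_lt (H : (ofProd q₀).HasTwoFrequencies)
    (hs : ∀ i, (ofProd q₀).sinVal i ≠ 0) {i j : Fin 2} {k n : ℕ}
    (h : (ofProd q₀).critDelay i k < (ofProd q₀).critDelay j n) :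
    ∀ᶠ q in 𝓝 q₀, (ofProd q).critDelay i k < (ofProd q).critDelay j n :=
  (continuousAt_critDelay H i (hs i) k).eventually_lt (continuousAt_critDelay H j (hs j) n) h

/-- Near the model system with `ε = 1` and frequency ratio `1 + 1 / (2 m + 1)` there are `2 m + 1`
switches. -/
lemma eventually_numSwitches_odd (m : ℕ) : ∃ q₀, ∀ᶠ q in 𝓝 q₀,
    |(ofProd q).a11 * (ofProd q).a22| < |(ofProd q).a12 * (ofProd q).a21| ∧
      (ofProd q).numSwitches = ((2 * m + 1 : ℕ) : ℕ∞) := by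
  set δ : ℝ := 1 / (2 * m + 1) with hδ
  have hδ0 : 0 < δ := by positivity
  have hδm : δ * (2 * m + 1) = 1 := by rw [hδ]; field_simp
  have hρ : 1 < 1 + δ := by linarith
  have hε : (1 : ℝ) ^ 2 = 1 := one_pow 2
  set q₀ := model 1 (1 + δ) with hq₀
  have H : (ofProd q₀).HasTwoFrequencies := hasTwoFrequencies_model hε hρ
  have hs0 := sinVal_model_zero hε hρ
  have hs1 := sinVal_model_one hε hρ
  have hs : ∀ i, (ofProd q₀).sinVal i ≠ 0 := Fin.forall_fin_two.2
    ⟨by rw [hq₀, hs0]; norm_num, by rw [hq₀, hs1]; norm_num⟩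
  have hc0 : ∀ k : ℕ, (ofProd q₀).critDelay 0 k = Real.pi / 2 * (3 + 4 * k) := by
    intro k
    rw [critDelay, phase_model_of_neg hs0, omega_model_zero hε hρ]
    ring
  have hc1 : ∀ k : ℕ, (ofProd q₀).critDelay 1 k = Real.pi / 2 * ((1 + 4 * k) / (1 + δ)) := by
    intro k
    rw [critDelay, phase_model_of_pos hs1, omega_model_one hε hρ]
    ring
  have hpi : 0 < Real.pi / 2 := by positivity
  have hA : ∀ k ∈ Finset.range m, ∀ᶠ q in 𝓝 q₀,
      (ofProd q).critDelay 1 k < (ofProd q).critDelay 0 k ∧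
      (ofProd q).critDelay 0 k < (ofProd q).critDelay 1 (k + 1) := by
    intro k hk
    have hkm : (k : ℝ) + 1 ≤ m := by exact_mod_cast Finset.mem_range.1 hk
    have hk0 : (0 : ℝ) ≤ k := Nat.cast_nonneg k
    refine (eventually_critDelay_lt H hs ?_).and (eventually_critDelay_lt H hs ?_)
    · rw [hc0, hc1]
      refine mul_lt_mul_of_pos_left ?_ hpi
      rw [div_lt_iff₀ (by linarith)]
      nlinarith
    · rw [hc0, hc1]
      refine mul_lt_mul_of_pos_left ?_ hpi
      rw [lt_div_iff₀ (by linarith)]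
      push_cast
      nlinarith
  have hB : ∀ᶠ q in 𝓝 q₀, (ofProd q).critDelay 1 (m + 1) < (ofProd q).critDelay 0 m := by
    refine eventually_critDelay_lt H hs ?_
    rw [hc0, hc1]
    refine mul_lt_mul_of_pos_left ?_ hpi
    rw [div_lt_iff₀ (by linarith)]
    push_cast
    nlinarith
  have htr : ∀ᶠ q in 𝓝 q₀, (ofProd q).a11 + (ofProd q).a22 < 0 := by
    have : ContinuousAt (fun q => (ofProd q).a11 + (ofProd q).a22) q₀ := by
      unfold ofProd; fun_prop
    refine this.eventually_lt_const ?_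
    simp only [ofProd, hq₀, model]
    linarith
  have hdet : ∀ᶠ q in 𝓝 q₀,
      0 < (ofProd q).a11 * (ofProd q).a22 - (ofProd q).a12 * (ofProd q).a21 := by
    have : ContinuousAt (fun q => (ofProd q).a11 * (ofProd q).a22
        - (ofProd q).a12 * (ofProd q).a21) q₀ := by
      unfold ofProd; fun_prop
    refine this.eventually_const_lt ?_
    simp only [ofProd, hq₀, model]
    linarith
  refine ⟨q₀, ?_⟩
  filter_upwards [eventually_hasTwoFrequencies H, (Finset.eventually_all _).2 hA, hB, htr, hdet]
    with q Hq h1 h2 h3 h4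
  exact ⟨Hq.abs_lt, (Hq.numSwitches_of_isStable_zero (Hq.isStable_zero h3 h4) m
    fun k hk => h1 k (Finset.mem_range.2 hk)).2 h2.le⟩

/-- Near the model system with `ε = -1` and frequency ratio `1 + 4 / (8 m + 1)` there are `2 m`
switches. -/
lemma eventually_numSwitches_even (m : ℕ) : ∃ q₀, ∀ᶠ q in 𝓝 q₀,
    |(ofProd q).a11 * (ofProd q).a22| < |(ofProd q).a12 * (ofProd q).a21| ∧
      (ofProd q).numSwitches = ((2 * m : ℕ) : ℕ∞) := by
  set δ : ℝ := 4 / (8 * m + 1) with hδ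
  have hδ0 : 0 < δ := by positivity
  have hδm : δ * (8 * m + 1) = 4 := by rw [hδ]; field_simp
  have hρ : 1 < 1 + δ := by linarith
  have hε : (-1 : ℝ) ^ 2 = 1 := by norm_num
  set q₀ := model (-1) (1 + δ) with hq₀
  have H : (ofProd q₀).HasTwoFrequencies := hasTwoFrequencies_model hε hρ
  have hs0 : (ofProd q₀).sinVal 0 = 1 := (sinVal_model_zero hε hρ).trans (neg_neg 1)
  have hs1 := sinVal_model_one hε hρ
  have hs : ∀ i, (ofProd q₀).sinVal i ≠ 0 := Fin.forall_fin_two.2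
    ⟨by rw [hs0]; norm_num, by rw [hq₀, hs1]; norm_num⟩
  have hc0 : ∀ k : ℕ, (ofProd q₀).critDelay 0 k = Real.pi / 2 * (1 + 4 * k) := by
    intro k
    rw [critDelay, phase_model_of_pos hs0, omega_model_zero hε hρ]
    ring
  have hc1 : ∀ k : ℕ, (ofProd q₀).critDelay 1 k = Real.pi / 2 * ((3 + 4 * k) / (1 + δ)) := by
    intro k
    rw [critDelay, phase_model_of_neg hs1, omega_model_one hε hρ]
    ring
  have hpi : 0 < Real.pi / 2 := by positivity
  have hA : ∀ k ∈ Finset.range m, ∀ᶠ q in 𝓝 q₀,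
      (ofProd q).critDelay 0 k < (ofProd q).critDelay 1 k ∧
      (ofProd q).critDelay 1 k < (ofProd q).critDelay 0 (k + 1) := by
    intro k hk
    have hkm : (k : ℝ) + 1 ≤ m := by exact_mod_cast Finset.mem_range.1 hk
    have hk0 : (0 : ℝ) ≤ k := Nat.cast_nonneg k
    refine (eventually_critDelay_lt H hs ?_).and (eventually_critDelay_lt H hs ?_)
    · rw [hc0, hc1]
      refine mul_lt_mul_of_pos_left ?_ hpi
      rw [lt_div_iff₀ (by linarith)]
      nlinarith
    · rw [hc0, hc1]
      refine mul_lt_mul_of_pos_left ?_ hpi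
      rw [div_lt_iff₀ (by linarith)]
      push_cast
      nlinarith
  have hB : ∀ᶠ q in 𝓝 q₀, (ofProd q).critDelay 1 m < (ofProd q).critDelay 0 m := by
    refine eventually_critDelay_lt H hs ?_
    rw [hc0, hc1]
    refine mul_lt_mul_of_pos_left ?_ hpi
    rw [div_lt_iff₀ (by linarith)]
    nlinarith
  have htr : ∀ᶠ q in 𝓝 q₀, 0 < (ofProd q).a11 + (ofProd q).a22 := by
    have : ContinuousAt (fun q => (ofProd q).a11 + (ofProd q).a22) q₀ := by
      unfold ofProd; fun_prop
    refine this.eventually_const_lt ?_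
    simp only [ofProd, hq₀, model]
    linarith
  refine ⟨q₀, ?_⟩
  filter_upwards [eventually_hasTwoFrequencies H, (Finset.eventually_all _).2 hA, hB, htr]
    with q Hq h1 h2 h3
  exact ⟨Hq.abs_lt, (Hq.numSwitches_of_isUnstable_zero (Hq.isUnstable_zero h3) m
    (fun k hk => (h1 k (Finset.mem_range.2 hk)).1)
    fun k hk => (h1 k (Finset.mem_range.2 (by omega))).2).2 h2.le⟩

end Coeffs

theorem theorem2 :
    -- every number of switches occurs on a box of coefficients
    (∀ n : ℕ, ∃ l u : Coeffs,
      l.a11 < u.a11 ∧ l.a12 < u.a12 ∧ l.a21 < u.a21 ∧ l.a22 < u.a22 ∧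
      ∀ a : Coeffs, a.a11 ∈ Ioo l.a11 u.a11 → a.a12 ∈ Ioo l.a12 u.a12 →
        a.a21 ∈ Ioo l.a21 u.a21 → a.a22 ∈ Ioo l.a22 u.a22 →
        |a.a11 * a.a22| < |a.a12 * a.a21| ∧ a.numSwitches = n) ∧
    -- sufficient conditions
    (∀ a : Coeffs, |a.a11 * a.a22| < |a.a12 * a.a21| → 0 < a.Delta →
      0 < a.a11 ^ 2 - a.a22 ^ 2 - 2 * (a.a12 * a.a21) →
      (a.IsStable 0 → ∀ m : ℕ,
        (∀ k < m, a.critDelay 1 k < a.critDelay 0 k ∧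
          a.critDelay 0 k < a.critDelay 1 (k + 1)) →
        ((2 * m + 1 : ℕ) : ℕ∞) ≤ a.numSwitches ∧
        (a.critDelay 1 (m + 1) ≤ a.critDelay 0 m →
          a.numSwitches = ((2 * m + 1 : ℕ) : ℕ∞))) ∧
      (a.IsUnstable 0 → ∀ m : ℕ,
        (∀ k < m, a.critDelay 0 k < a.critDelay 1 k) →
        (∀ k, k + 1 < m → a.critDelay 1 k < a.critDelay 0 (k + 1)) →
        ((2 * m : ℕ) : ℕ∞) ≤ a.numSwitches ∧
        (a.critDelay 1 m ≤ a.critDelay 0 m →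
          a.numSwitches = ((2 * m : ℕ) : ℕ∞)))) := by
  refine ⟨fun n => ?_, fun a h1 h2 h3 => ?_⟩
  · obtain ⟨q₀, hq⟩ : ∃ q₀, ∀ᶠ q in 𝓝 q₀,
        |(Coeffs.ofProd q).a11 * (Coeffs.ofProd q).a22|
            < |(Coeffs.ofProd q).a12 * (Coeffs.ofProd q).a21| ∧
          (Coeffs.ofProd q).numSwitches = n := by
      rcases Nat.even_or_odd' n with ⟨m, rfl | rfl⟩
      · exact Coeffs.eventually_numSwitches_even m
      · exact Coeffs.eventually_numSwitches_odd m
    exact Coeffs.exists_box (P := fun a => |a.a11 * a.a22| < |a.a12 * a.a21| ∧ a.numSwitches = n) hq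
  · have H : a.HasTwoFrequencies := ⟨h1, h2, h3⟩
    exact ⟨H.numSwitches_of_isStable_zero, H.numSwitches_of_isUnstable_zero⟩
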